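/- A flat torus is a quotient $T=\mathbb{R}^2/\Lambda$ of the Euclidean plane by a (rank-two) lattice $\Lambda$ of translations, with the quotient metric. It has reflection symmetry if it admits an orientation-reversing self-isometry; equivalently, if some reflection of $\mathbb{R}^2$ in a line through the origin preserves $\Lambda$. A paper torus realizing $T$ is a piecewise linear isometric embedding $\phi:T\to\mathbb{R}^3$: a topological embedding whose image is the underlying space of a finite simplicial complex in $\mathbb{R}^3$ made of triangles (with their edges and vertices), such that each of these triangles is the image under $\phi$ of a flat triangle of $T$ on which $\phi$ is an affine isometry. It is an $n$-vertex paper torus if this complex can be chosen with exactly $n$ vertices. Theorem. Let $T$ be a flat torus that does not have reflection symmetry. Then $T$ is realized by an $8$-vertex paper torus. -/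

import Mathlib

namespace PaperTorus

/-- The Euclidean plane `ℝ²`. -/
abbrev E2 : Type := EuclideanSpace ℝ (Fin 2)

/-- Euclidean space `ℝ³`. -/
abbrev E3 : Type := EuclideanSpace ℝ (Fin 3)

/-- The flat torus `ℝ² / Λ`, where `Λ` is a lattice (of translations) in `ℝ²`. Its metric is the
quotient metric, `dist [x] [y] = inf_{v ∈ Λ} ‖x - y + v‖`. -/
abbrev FlatTorus (Λ : Submodule ℤ E2) [DiscreteTopology Λ] [IsZLattice ℝ Λ] : Type := E2 ⧸ Λ

/-- The universal covering map `ℝ² → ℝ² / Λ`. -/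
def cover (Λ : Submodule ℤ E2) [DiscreteTopology Λ] [IsZLattice ℝ Λ] : E2 → FlatTorus Λ :=
  fun x => Submodule.Quotient.mk x

/-- The flat torus `ℝ² / Λ` has a reflection symmetry: it has an orientation-reversing
self-isometry, that is, a self-isometry `f` that lifts to an isometry `A` of the plane whose linear
part has negative determinant. (The linear part of `A` is then a reflection of the plane in a line
through the origin that preserves `Λ`, and so it also induces a self-isometry of the torus.) -/
def HasReflectionSymmetry (Λ : Submodule ℤ E2) [DiscreteTopology Λ] [IsZLattice ℝ Λ] : Prop :=
  ∃ (f : FlatTorus Λ ≃ᵢ FlatTorus Λ) (A : E2 ≃ᵃⁱ[ℝ] E2),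
    LinearMap.det (A.toAffineEquiv.linear : E2 →ₗ[ℝ] E2) < 0 ∧
      ∀ x : E2, f (cover Λ x) = cover Λ (A x)

/-- `φ : ℝ² / Λ → ℝ³` is a paper torus, triangulated by the geometric simplicial complex `K`:
it is a topological embedding with image the underlying space of `K`, the complex `K` is made of
triangles with their edges and vertices, and `φ` maps a flat triangle of the torus onto each
triangle of `K` by an affine isometry. -/
structure IsPaperTorus (Λ : Submodule ℤ E2) [DiscreteTopology Λ] [IsZLattice ℝ Λ]
    (K : Geometry.SimplicialComplex ℝ E3) (φ : FlatTorus Λ → E3) : Prop where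
  isEmbedding : Topology.IsEmbedding φ
  range_eq : Set.range φ = K.space
  pure : ∀ s ∈ K.faces, ∃ t ∈ K.faces, s ⊆ t ∧ t.card = 3
  isometric : ∀ t ∈ K.faces, t.card = 3 → ∃ g : E2 →ᵃⁱ[ℝ] E3,
    convexHull ℝ (t : Set E3) ⊆ Set.range g ∧
      ∀ x : E2, g x ∈ convexHull ℝ (t : Set E3) → φ (cover Λ x) = g x

/-- The flat torus `ℝ² / Λ` is realized by a paper torus with exactly `n` vertices. -/
def IsRealizedByPaperTorus (Λ : Submodule ℤ E2) [DiscreteTopology Λ] [IsZLattice ℝ Λ] (n : ℕ) :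
    Prop :=
  ∃ (K : Geometry.SimplicialComplex ℝ E3) (φ : FlatTorus Λ → E3),
    K.vertices.Finite ∧ K.vertices.ncard = n ∧ IsPaperTorus Λ K φ

end PaperTorus

/-! Triangulate the torus by the integer grid, each square cut by its rising diagonal, modulo the
sublattice `m + 2n ≡ 0 (mod 8)`. The eight vertices are the residues mod 8 and the sixteen triangles
are the translates of `{0,1,3}` and `{0,2,3}`. By `isRealizedByPaperTorus_of_vertices` it suffices
to find a `Λ`-periodic position in the plane for each grid point, such that the piecewise linear
extension is a homeomorphism, together with eight points of space that have the same edge lengths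
and span an embedded complex.

By Gauss reduction (`exists_shape`), `Λ` is similar to the lattice generated by `(2, 0)` and `2D`,
where `D = (x, y)`, `0 ≤ x ≤ 1/2` and `|D| ≥ 1`. The values `x = 0` and `x = 1/2` give reflection
symmetries, so `0 < x < 1/2`. Everything is made symmetric under the involution `v ↦ -v` of the
torus, which exchanges the labels `k` and `7 - k` and becomes a half-turn about a vertical axis in
space. This leaves fourteen length equations (`IsFolding`).

They are first solved with six vertices in a horizontal plane and the two others at height `H`. The
six triangles that avoid the two apexes then overlap in that plane. Such solutions form a
one-parameter family (`exists_flat_tent`) starting at an explicit corner configuration, where `H² =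
2x` and the base areas are multiples of `1/2 - x`. The bounds on `x` keep both from degenerating.
The overlapping sheets are pulled apart by the heights `0`, `ε`, `2ε`, and the length equations are
solved again for small `ε` by an implicit function argument (`exists_folding_of_flat`).

Embeddedness depends only on the orientations of the 70 quadruples of vertices: with the right
signs, any two triangles are weakly separated by a plane through three vertices, a finite check
(`uniqueWeights_of_orientations`). The signs follow from a few strict inequalities between areas
(`IsTent`). These inequalities, like the edge directions that make the development a homeomorphism
(`IsSpread`), are open conditions and so survive the perturbation. -/

namespace PaperTorus

/-! ### Piecewise linear interpolation on the triangulated integer grid -/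

section Interpolation

variable {V W : Type*} [AddCommGroup V] [Module ℝ V] [AddCommGroup W] [Module ℝ W]

/-- The affine formula for the interpolation on the unit square with lower left corner `(m, n)`,
subdivided by the diagonal from `(m, n)` to `(m + 1, n + 1)`. -/
noncomputable def cellInterp (p : ℤ → ℤ → V) (m n : ℤ) (s r : ℝ) : V :=
  -- The first three terms are the affine map through three corners. The mixed difference corrects
  -- the value at `(m + 1, n + 1)`, and its factor `min` is affine on each side of the diagonal.
  p m n + (s - m) • (p (m + 1) n - p m n) + (r - n) • (p m (n + 1) - p m n) +
    min (s - m) (r - n) • (p (m + 1) (n + 1) - p (m + 1) n - p m (n + 1) + p m n)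

/-- Piecewise linear extension to the plane of a map defined on the integer grid. -/
noncomputable def interp (p : ℤ → ℤ → V) (z : ℝ × ℝ) : V := cellInterp p ⌊z.1⌋ ⌊z.2⌋ z.1 z.2

lemma cellInterp_right (p : ℤ → ℤ → V) (m n : ℤ) {r : ℝ} (hr : n ≤ r) (hr' : r ≤ n + 1) :
    cellInterp p m n (m + 1) r = cellInterp p (m + 1) n (m + 1) r := by
  have h1 : min ((m : ℝ) + 1 - m) (r - n) = r - n := min_eq_right (by linarith)
  have h2 : min ((m : ℝ) + 1 - ((m + 1 : ℤ) : ℝ)) (r - n) = 0 := by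
    push_cast; rw [sub_self]; exact min_eq_left (by linarith)
  unfold cellInterp
  rw [h1, h2]
  push_cast
  module

lemma cellInterp_top (p : ℤ → ℤ → V) (m n : ℤ) {s : ℝ} (hs : m ≤ s) (hs' : s ≤ m + 1) :
    cellInterp p m n s (n + 1) = cellInterp p m (n + 1) s (n + 1) := by
  have h1 : min (s - m) ((n : ℝ) + 1 - n) = s - m := min_eq_left (by linarith)
  have h2 : min (s - m) ((n : ℝ) + 1 - ((n + 1 : ℤ) : ℝ)) = 0 := by
    push_cast; rw [sub_self]; exact min_eq_right (by linarith)
  unfold cellInterp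
  rw [h1, h2]
  push_cast
  module

/-- On the right or top edge of the closed cell the floor already points to the next cell, but the
two formulas agree on the common edge. The closed version is what gives continuity and cellwise
monotonicity. -/
lemma interp_eq_cellInterp (p : ℤ → ℤ → V) (m n : ℤ) {s r : ℝ} (hs : m ≤ s) (hs' : s ≤ m + 1)
    (hr : n ≤ r) (hr' : r ≤ n + 1) : interp p (s, r) = cellInterp p m n s r := by
  unfold interp
  have hfl : ∀ (k : ℤ) (t : ℝ), k ≤ t → t ≤ k + 1 → ⌊t⌋ = k ∨ (t = k + 1 ∧ ⌊t⌋ = k + 1) := by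
    intro k t h h'
    rcases h'.lt_or_eq with h' | h'
    · exact Or.inl (Int.floor_eq_iff.2 ⟨h, h'⟩)
    · refine Or.inr ⟨h', ?_⟩
      rw [h']
      exact_mod_cast Int.floor_intCast (k + 1)
  rcases hfl m s hs hs' with h1 | ⟨rfl, h1⟩ <;> rcases hfl n r hr hr' with h2 | ⟨rfl, h2⟩ <;>
    simp only [h1, h2]
  · exact (cellInterp_top p m n hs hs').symm
  · exact (cellInterp_right p m n hr hr').symm
  · rw [cellInterp_right p m n hr hr']
    refine (cellInterp_top p (m + 1) n ?_ ?_).symm <;> push_cast <;> linarith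

lemma interp_lower (p : ℤ → ℤ → V) (m n : ℤ) {b c : ℝ} (hb : 0 ≤ b) (hc : 0 ≤ c)
    (hbc : b + c ≤ 1) : interp p (m + b + c, n + c) =
      (1 - b - c) • p m n + b • p (m + 1) n + c • p (m + 1) (n + 1) := by
  rw [interp_eq_cellInterp p m n (by linarith) (by linarith) (by linarith) (by linarith)]
  unfold cellInterp
  rw [min_eq_right (by linarith)]
  module

lemma interp_upper (p : ℤ → ℤ → V) (m n : ℤ) {b c : ℝ} (hb : 0 ≤ b) (hc : 0 ≤ c)
    (hbc : b + c ≤ 1) : interp p (m + c, n + b + c) =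
      (1 - b - c) • p m n + b • p m (n + 1) + c • p (m + 1) (n + 1) := by
  rw [interp_eq_cellInterp p m n (by linarith) (by linarith) (by linarith) (by linarith)]
  unfold cellInterp
  rw [min_eq_left (by linarith)]
  module

lemma map_interp (L : V →ₗ[ℝ] W) (p : ℤ → ℤ → V) (z : ℝ × ℝ) :
    L (interp p z) = interp (fun m n => L (p m n)) z := by
  simp [interp, cellInterp]

lemma interp_add_int (p : ℤ → ℤ → V) (z : ℝ × ℝ) (i j : ℤ) :
    interp p (z + ((i : ℝ), (j : ℝ))) = interp (fun m n => p (m + i) (n + j)) z := by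
  have e1 : ∀ a : ℤ, a + i + 1 = a + 1 + i := fun a => by ring
  have e2 : ∀ a : ℤ, a + j + 1 = a + 1 + j := fun a => by ring
  simp only [interp, cellInterp, Prod.fst_add, Prod.snd_add, Int.floor_add_intCast, e1, e2]
  push_cast
  simp only [add_sub_add_right_eq_sub]

lemma interp_add_const (p : ℤ → ℤ → V) (v : V) (z : ℝ × ℝ) :
    interp (fun m n => p m n + v) z = interp p z + v := by
  simp only [interp, cellInterp]
  module

lemma continuous_interp [TopologicalSpace V] [ContinuousAdd V] [ContinuousSMul ℝ V]
    (p : ℤ → ℤ → V) : Continuous (interp p) := by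
  let S : ℤ × ℤ → Set (ℝ × ℝ) := fun k => Set.Icc (k.1 : ℝ) (k.1 + 1) ×ˢ Set.Icc (k.2 : ℝ) (k.2 + 1)
  have hlf : LocallyFinite S := by
    intro z
    refine ⟨Set.Ioo (z.1 - 1) (z.1 + 1) ×ˢ Set.Ioo (z.2 - 1) (z.2 + 1),
      prod_mem_nhds (Ioo_mem_nhds (by linarith) (by linarith))
        (Ioo_mem_nhds (by linarith) (by linarith)), ?_⟩
    refine ((Set.finite_Icc (⌊z.1⌋ - 2) (⌊z.1⌋ + 2)).prod
      (Set.finite_Icc (⌊z.2⌋ - 2) (⌊z.2⌋ + 2))).subset ?_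
    rintro ⟨i, j⟩ ⟨w, ⟨⟨h1, h2⟩, h3, h4⟩, ⟨h5, h6⟩, h7, h8⟩
    have key : ∀ (k : ℤ) (t w : ℝ), k ≤ w → w ≤ k + 1 → t - 1 < w → w < t + 1 →
        k ∈ Set.Icc (⌊t⌋ - 2) (⌊t⌋ + 2) := by
      intro k t w a b c d
      have e1 := Int.floor_le t
      have e2 := Int.lt_floor_add_one t
      have f1 : ((⌊t⌋ : ℝ)) < (k + 2 : ℤ) := by push_cast; linarith
      have f2 : (k : ℝ) < (⌊t⌋ + 2 : ℤ) := by push_cast; linarith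
      have := Int.cast_lt.1 f1
      have := Int.cast_lt.1 f2
      constructor <;> omega
    exact ⟨key i z.1 w.1 h1 h2 h5 h6, key j z.2 w.2 h3 h4 h7 h8⟩
  refine hlf.continuous ?_ (fun k => isClosed_Icc.prod isClosed_Icc) ?_
  · refine Set.eq_univ_of_forall fun z => Set.mem_iUnion.2 ⟨(⌊z.1⌋, ⌊z.2⌋), ?_⟩
    exact ⟨⟨Int.floor_le _, (Int.lt_floor_add_one _).le⟩, Int.floor_le _,
      (Int.lt_floor_add_one _).le⟩
  · rintro ⟨i, j⟩
    have hc : Continuous fun z : ℝ × ℝ => cellInterp p i j z.1 z.2 := by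
      unfold cellInterp
      fun_prop
    refine hc.continuousOn.congr ?_
    rintro ⟨s, r⟩ ⟨⟨h1, h2⟩, h3, h4⟩
    exact interp_eq_cellInterp p i j h1 h2 h3 h4

end Interpolation

/-! ### Monotonicity of real interpolations -/

lemma antitone_of_antitoneOn_Icc_int {g : ℝ → ℝ}
    (h : ∀ m : ℤ, AntitoneOn g (Set.Icc (m : ℝ) (m + 1))) : Antitone g := by
  have hint : Antitone fun m : ℤ => g m := by
    refine antitone_int_of_succ_le fun m => ?_
    have := h m (Set.left_mem_Icc.2 (by linarith)) (Set.right_mem_Icc.2 (by linarith))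
      (by linarith : (m : ℝ) ≤ m + 1)
    simpa using this
  intro s t hst
  have a1 := Int.floor_le s
  have a2 := Int.lt_floor_add_one s
  have b1 := Int.floor_le t
  have b2 := Int.lt_floor_add_one t
  rcases (Int.floor_mono hst).eq_or_lt with hf | hf
  · exact h ⌊s⌋ ⟨a1, a2.le⟩ (by rw [hf]; exact ⟨b1, b2.le⟩) hst
  · have h1 : g (⌊s⌋ + 1) ≤ g s :=
      h ⌊s⌋ ⟨a1, a2.le⟩ (Set.right_mem_Icc.2 (by linarith)) a2.le
    have h2 : g t ≤ g ⌊t⌋ := h ⌊t⌋ (Set.left_mem_Icc.2 (by linarith)) ⟨b1, b2.le⟩ b1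
    have h3 := hint (show ⌊s⌋ + 1 ≤ ⌊t⌋ by omega)
    simp only [Int.cast_add, Int.cast_one] at h3
    linarith

lemma interp_sub_le_fst {p : ℤ → ℤ → ℝ} {c : ℝ} (hp : ∀ m n, p (m + 1) n - p m n ≤ c) {s s' : ℝ}
    (hs : s ≤ s') (r : ℝ) : interp p (s', r) - interp p (s, r) ≤ c * (s' - s) := by
  have := antitone_of_antitoneOn_Icc_int (g := fun s => interp p (s, r) - c * s) (by
    rintro m s ⟨h1, h2⟩ s' ⟨h3, h4⟩ hss
    have hr := Int.floor_le r
    have hr' := (Int.lt_floor_add_one r).le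
    simp only [interp_eq_cellInterp p m ⌊r⌋ h1 h2 hr hr', interp_eq_cellInterp p m ⌊r⌋ h3 h4 hr hr',
      cellInterp, smul_eq_mul]
    -- The `min` grows by an amount between `0` and `s' - s`, so the change of the interpolation is
    -- a nonnegative combination, of total weight `s' - s`, of the horizontal increments in the two
    -- neighbouring rows.
    have d0 : min (s - m) (r - ⌊r⌋) ≤ min (s' - m) (r - ⌊r⌋) := min_le_min_right _ (by linarith)
    have d1 : min (s' - m) (r - ⌊r⌋) ≤ min (s - m) (r - ⌊r⌋) + (s' - s) := by
      rcases le_total (s - m) (r - ⌊r⌋) with h | h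
      · rw [min_eq_left h]
        exact (min_le_left _ _).trans (by linarith)
      · rw [min_eq_right h]
        exact (min_le_right _ _).trans (by linarith)
    have := hp m ⌊r⌋
    have := hp m (⌊r⌋ + 1)
    generalize min (s' - m) (r - ⌊r⌋) = μ' at *
    generalize min (s - m) (r - ⌊r⌋) = μ at *
    nlinarith [mul_nonneg (sub_nonneg.2 d0) (sub_nonneg.2 (hp m (⌊r⌋ + 1))),
      mul_nonneg (sub_nonneg.2 d1) (sub_nonneg.2 (hp m ⌊r⌋))]) hs
  simp only at this
  linarith

lemma interp_swap (p : ℤ → ℤ → ℝ) (s r : ℝ) : interp p (s, r) = interp (fun m n => p n m) (r, s) := by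
  simp only [interp, cellInterp, smul_eq_mul, min_comm (s - _)]
  ring

lemma interp_neg (p : ℤ → ℤ → ℝ) (z : ℝ × ℝ) : interp (fun m n => - p m n) z = - interp p z := by
  simp only [interp, cellInterp, smul_eq_mul]
  ring

lemma le_interp_sub_fst {p : ℤ → ℤ → ℝ} {c : ℝ} (hp : ∀ m n, c ≤ p (m + 1) n - p m n) {s s' : ℝ}
    (hs : s ≤ s') (r : ℝ) : c * (s' - s) ≤ interp p (s', r) - interp p (s, r) := by
  have := interp_sub_le_fst (p := fun m n => - p m n) (c := -c)
    (fun m n => by linarith [hp m n]) hs r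
  simp only [interp_neg] at this
  linarith

lemma le_interp_sub_snd {p : ℤ → ℤ → ℝ} {c : ℝ} (hp : ∀ m n, c ≤ p m (n + 1) - p m n) (s : ℝ)
    {r r' : ℝ} (hr : r ≤ r') : c * (r' - r) ≤ interp p (s, r') - interp p (s, r) := by
  rw [interp_swap, interp_swap p s r]
  exact le_interp_sub_fst (fun m n => hp n m) hr s

lemma surjective_of_rate {g : ℝ → ℝ} (hg : Continuous g) {c : ℝ} (hc : 0 < c)
    (h : ∀ s s', s ≤ s' → c * (s' - s) ≤ g s' - g s) : Function.Surjective g := by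
  refine hg.surjective ?_ ?_
  · refine Filter.tendsto_atTop_mono' _ ?_
      (Filter.tendsto_atTop_add_const_right _ (g 0) (Filter.tendsto_id.const_mul_atTop hc))
    filter_upwards [Filter.eventually_ge_atTop 0] with s hs
    have := h 0 s hs
    simp only [id]
    linarith
  · refine Filter.tendsto_atBot_mono' _ ?_
      (Filter.tendsto_atBot_add_const_right _ (g 0) (Filter.tendsto_id.const_mul_atBot hc))
    filter_upwards [Filter.eventually_le_atBot 0] with s hs
    have := h s 0 hs
    simp only [id]
    linarith

/-- A map of the plane whose first coordinate decreases in the first variable and increases in the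
second one, and whose second coordinate increases in both variables, all at a definite rate, is a
homeomorphism. -/
theorem exists_homeomorph_of_rates {f : ℝ × ℝ → ℝ × ℝ} (hf : Continuous f) {c : ℝ} (hc : 0 < c)
    (hu1 : ∀ s s' r, s ≤ s' → (f (s', r)).1 - (f (s, r)).1 ≤ -c * (s' - s))
    (hu2 : ∀ s r r', r ≤ r' → c * (r' - r) ≤ (f (s, r')).1 - (f (s, r)).1)
    (hv1 : ∀ s s' r, s ≤ s' → c * (s' - s) ≤ (f (s', r)).2 - (f (s, r)).2)
    (hv2 : ∀ s r r', r ≤ r' → c * (r' - r) ≤ (f (s, r')).2 - (f (s, r)).2) :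
    ∃ e : (ℝ × ℝ) ≃ₜ (ℝ × ℝ), ⇑e = f := by
  -- If both variables move in the same direction, their effects on the second coordinate add up. If
  -- they move in opposite directions, their effects on the first coordinate do. Either way `f`
  -- expands distances by at least the factor `c`.
  have key : ∀ s s' r r', s ≤ s' → c * (|s' - s| + |r' - r|) ≤ dist (f (s', r')) (f (s, r)) := by
    intro s s' r r' hs
    rw [Prod.dist_eq, Real.dist_eq, Real.dist_eq, abs_of_nonneg (sub_nonneg.2 hs)]
    rcases le_total r r' with hr | hr
    · rw [abs_of_nonneg (sub_nonneg.2 hr)]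
      refine le_trans ?_ (le_max_right _ _)
      refine le_trans ?_ (le_abs_self _)
      linarith [hv1 s s' r hs, hv2 s' r r' hr]
    · rw [abs_of_nonpos (sub_nonpos.2 hr)]
      refine le_trans ?_ (le_max_left _ _)
      refine le_trans ?_ (neg_le_abs _)
      linarith [hu1 s s' r hs, hu2 s' r' r hr]
  have key' : ∀ z w : ℝ × ℝ, c * dist z w ≤ dist (f z) (f w) := by
    have : ∀ z w : ℝ × ℝ, w.1 ≤ z.1 → c * dist z w ≤ dist (f z) (f w) := by
      intro z w h
      refine le_trans (mul_le_mul_of_nonneg_left ?_ hc.le) (key w.1 z.1 w.2 z.2 h)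
      rw [Prod.dist_eq, Real.dist_eq, Real.dist_eq]
      exact max_le_add_of_nonneg (abs_nonneg _) (abs_nonneg _)
    intro z w
    rcases le_total w.1 z.1 with h | h
    · exact this z w h
    · rw [dist_comm, dist_comm (f z)]
      exact this w z h
  have hal : AntilipschitzWith (Real.toNNReal c⁻¹) f := by
    refine AntilipschitzWith.of_le_mul_dist fun z w => ?_
    rw [Real.coe_toNNReal _ (inv_pos.2 hc).le, inv_mul_eq_div, le_div_iff₀ hc, mul_comm]
    exact key' z w
  have hsurj : Function.Surjective f := by
    rintro ⟨α, β⟩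
    -- The level set `β` of the second coordinate is the graph of a decreasing function `ρ`,
    -- continuous because it is monotone and surjective. Along this graph the first coordinate
    -- decreases at rate at least `c`, hence takes the value `α`.
    have h1 : ∀ s, ∃ r, (f (s, r)).2 = β := fun s =>
      surjective_of_rate (g := fun r => (f (s, r)).2) (by fun_prop) hc (fun r r' h => hv2 s r r' h) β
    choose ρ hρ using h1
    have h2 : ∀ r, ∃ s, ρ s = r := by
      intro r
      obtain ⟨s, hs⟩ := surjective_of_rate (g := fun s => (f (s, r)).2) (by fun_prop) hc
        (fun s s' h => hv1 s s' r h) β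
      refine ⟨s, ?_⟩
      have h3 := hρ s
      simp only at hs
      rcases le_total r (ρ s) with h | h
      · nlinarith [hv2 s r (ρ s) h]
      · nlinarith [hv2 s (ρ s) r h]
    have hanti : Antitone ρ := by
      intro s s' hs
      by_contra! hlt
      have a := hv1 s s' (ρ s') hs
      have b := hv2 s (ρ s) (ρ s') hlt.le
      rw [hρ] at a b
      nlinarith [mul_pos hc (sub_pos.2 hlt), mul_nonneg hc.le (sub_nonneg.2 hs)]
    have hcont : Continuous ρ := by
      have hm : Monotone fun s => ρ (-s) := fun a b h => hanti (neg_le_neg h)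
      have : Continuous fun s => ρ (-s) := hm.continuous_of_surjective fun r => by
        obtain ⟨s, hs⟩ := h2 r
        exact ⟨-s, by simpa using hs⟩
      simpa [Function.comp_def] using this.comp continuous_neg
    obtain ⟨s, hs⟩ := surjective_of_rate (g := fun s => -(f (s, ρ s)).1) (by fun_prop) hc (by
      intro s s' h
      have a := hu1 s s' (ρ s') h
      have b := hu2 s (ρ s') (ρ s) (hanti h)
      nlinarith [mul_nonneg hc.le (sub_nonneg.2 (hanti h))]) (-α)
    exact ⟨(s, ρ s), Prod.ext (by simpa using hs) (hρ s)⟩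
  exact ⟨(Equiv.ofBijective f ⟨hal.injective, hsurj⟩).toHomeomorphOfIsInducing
    (hal.isInducing hf), rfl⟩

end PaperTorus

namespace PaperTorus

/-! ### Simplicial complexes from uniqueness of barycentric coordinates -/

section Complex

variable {ι E : Type*} [Fintype ι] [AddCommGroup E] [Module ℝ E]

/-- `α` is a family of barycentric coordinates supported on `A`. -/
structure IsWeight (A : Set ι) (α : ι → ℝ) : Prop where
  nonneg : ∀ k, 0 ≤ α k
  sum_eq : ∑ k, α k = 1
  supp : ∀ k, k ∉ A → α k = 0

/-- Any point has at most one family of barycentric coordinates with respect to the points `P k`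
which is supported on some member of `T`. -/
def UniqueWeights (P : ι → E) (T : Set (Finset ι)) : Prop :=
  ∀ A ∈ T, ∀ B ∈ T, ∀ α β : ι → ℝ, IsWeight (A : Set ι) α → IsWeight (B : Set ι) β →
    ∑ k, α k • P k = ∑ k, β k • P k → α = β

lemma IsWeight.mono {A B : Set ι} {α : ι → ℝ} (h : IsWeight A α) (hAB : A ⊆ B) : IsWeight B α :=
  ⟨h.nonneg, h.sum_eq, fun k hk => h.supp k fun hk' => hk (hAB hk')⟩

lemma isWeight_single [DecidableEq ι] {A : Set ι} {k : ι} (hk : k ∈ A) : IsWeight A (Pi.single k (1 : ℝ)) := by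
  refine ⟨fun j => ?_, by simp, fun j hj => ?_⟩
  · rcases eq_or_ne j k with rfl | h
    · simp
    · simp [h]
  · exact Pi.single_eq_of_ne (fun h => hj (by rwa [h])) _

lemma IsWeight.sum_mem_convexHull {A : Set ι} {α : ι → ℝ} (h : IsWeight A α) {P : ι → E}
    {S : Set E} (hS : ∀ k ∈ A, P k ∈ S) : ∑ k, α k • P k ∈ convexHull ℝ S := by
  classical
  have h1 : ∑ k, α k • P k = ∑ k with k ∈ A, α k • P k := by
    rw [Finset.sum_filter]
    refine Finset.sum_congr rfl fun k _ => ?_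
    split_ifs with hk
    · rfl
    · rw [h.supp k hk, zero_smul]
  have h2 : ∑ k with k ∈ A, α k = 1 := by
    rw [Finset.sum_filter, ← h.sum_eq]
    refine Finset.sum_congr rfl fun k _ => ?_
    split_ifs with hk
    · rfl
    · rw [h.supp k hk]
  rw [h1]
  exact (convex_convexHull ℝ S).sum_mem (fun k _ => h.nonneg k) h2
    fun k hk => subset_convexHull ℝ S (hS k (Finset.mem_filter.1 hk).2)

lemma exists_isWeight_of_mem_convexHull {A : Set ι} {P : ι → E} {S : Set E} (hS : S ⊆ P '' A)
    {x : E} (hx : x ∈ convexHull ℝ S) :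
    ∃ α, IsWeight (A ∩ P ⁻¹' S) α ∧ ∑ k, α k • P k = x := by
  classical
  refine convexHull_min (t := {x | ∃ α, IsWeight (A ∩ P ⁻¹' S) α ∧ ∑ k, α k • P k = x}) ?_ ?_ hx
  · intro y hy
    obtain ⟨k, hk, rfl⟩ := hS hy
    exact ⟨Pi.single k 1, isWeight_single ⟨hk, hy⟩, by simp [Pi.single_apply, ite_smul]⟩
  · rintro y ⟨α, hα, rfl⟩ z ⟨β, hβ, rfl⟩ a b ha hb hab
    refine ⟨a • α + b • β, ⟨fun k => ?_, ?_, fun k hk => ?_⟩, ?_⟩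
    · exact add_nonneg (mul_nonneg ha (hα.nonneg k)) (mul_nonneg hb (hβ.nonneg k))
    · simp [Finset.sum_add_distrib, ← Finset.mul_sum, hα.sum_eq, hβ.sum_eq, hab]
    · simp [hα.supp k hk, hβ.supp k hk]
    · simp [add_smul, Finset.sum_add_distrib, Finset.smul_sum, mul_smul]

namespace UniqueWeights

variable {P : ι → E} {T : Set (Finset ι)}

lemma injective (h : UniqueWeights P T) (hT : ∀ k, ∃ A ∈ T, k ∈ A) : Function.Injective P := by
  classical
  intro k l hkl
  obtain ⟨A, hA, hk⟩ := hT k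
  obtain ⟨B, hB, hl⟩ := hT l
  have := h A hA B hB _ _ (isWeight_single (Finset.mem_coe.2 hk))
    (isWeight_single (Finset.mem_coe.2 hl)) (by simp [Pi.single_apply, ite_smul, hkl])
  by_contra hne
  have h1 := congrFun this k
  rw [Pi.single_eq_same, Pi.single_eq_of_ne hne] at h1
  exact one_ne_zero h1

/-- A common point of the two hulls has weights on `S` and weights on `S'`. By uniqueness these
coincide, so they live on the common vertices. -/
lemma inter_subset (h : UniqueWeights P T) {A B : Finset ι} (hA : A ∈ T) (hB : B ∈ T)
    {S S' : Set E} (hS : S ⊆ P '' A) (hS' : S' ⊆ P '' B) :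
    convexHull ℝ S ∩ convexHull ℝ S' ⊆ convexHull ℝ (S ∩ S') := by
  rintro x ⟨hx, hx'⟩
  obtain ⟨α, hα, rfl⟩ := exists_isWeight_of_mem_convexHull hS hx
  obtain ⟨β, hβ, hαβ⟩ := exists_isWeight_of_mem_convexHull hS' hx'
  have := h A hA B hB α β (hα.mono Set.inter_subset_left) (hβ.mono Set.inter_subset_left) hαβ.symm
  subst this
  have hw : IsWeight (P ⁻¹' (S ∩ S')) α := by
    refine ⟨hα.nonneg, hα.sum_eq, fun k hk => ?_⟩
    by_cases hk' : k ∈ P ⁻¹' S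
    · exact hβ.supp k fun hh => hk ⟨hk', hh.2⟩
    · exact hα.supp k fun hh => hk' hh.2
  exact hw.sum_mem_convexHull fun k hk => hk

variable [DecidableEq E]

/-- The geometric simplicial complex with vertices `P k` whose maximal faces are the images of the
members of `T`. -/
def complex (h : UniqueWeights P T) : Geometry.SimplicialComplex ℝ E where
  faces := {s | s.Nonempty ∧ ∃ A ∈ T, s ⊆ A.image P}
  isRelLowerSet_faces := by
    rintro s ⟨hs, A, hA, hsA⟩
    exact ⟨hs, fun t ht ht' => ⟨ht', A, hA, ht.trans hsA⟩⟩
  indep := by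
    rintro s ⟨hs, A, hA, hsA⟩
    by_contra hdep
    -- An affinely dependent face would split into two disjoint parts whose hulls meet, whereas
    -- `inter_subset` puts the common point in the hull of the empty set.
    obtain ⟨I, x, hx⟩ := Convex.radon_partition hdep
    have hsub : ∀ J : Set s, ((↑) : s → E) '' J ⊆ P '' (A : Set ι) := by
      rintro J _ ⟨y, -, rfl⟩
      simpa using hsA y.2
    have hmem := h.inter_subset hA hA (hsub I) (hsub Iᶜ) hx
    rw [← Set.image_inter Subtype.val_injective, Set.inter_compl_self, Set.image_empty,
      convexHull_empty] at hmem
    exact hmem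
  inter_subset_convexHull := by
    rintro s t ⟨hs, A, hA, hsA⟩ ⟨ht, B, hB, htB⟩
    refine h.inter_subset hA hB ?_ ?_
    · exact fun y hy => by simpa using hsA hy
    · exact fun y hy => by simpa using htB hy

lemma mem_faces (h : UniqueWeights P T) {s : Finset E} :
    s ∈ h.complex.faces ↔ s.Nonempty ∧ ∃ A ∈ T, s ⊆ A.image P := Iff.rfl

lemma vertices_eq_range (h : UniqueWeights P T) (hT : ∀ k, ∃ A ∈ T, k ∈ A) :
    h.complex.vertices = Set.range P := by
  ext x
  rw [Geometry.SimplicialComplex.mem_vertices, mem_faces]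
  constructor
  · rintro ⟨-, A, -, hx⟩
    obtain ⟨k, -, rfl⟩ := Finset.mem_image.1 (Finset.singleton_subset_iff.1 hx)
    exact ⟨k, rfl⟩
  · rintro ⟨k, rfl⟩
    obtain ⟨A, hA, hk⟩ := hT k
    exact ⟨Finset.singleton_nonempty _, A, hA,
      Finset.singleton_subset_iff.2 (Finset.mem_image_of_mem _ hk)⟩

lemma mem_space_iff (h : UniqueWeights P T) {x : E} :
    x ∈ h.complex.space ↔ ∃ A ∈ T, ∃ α, IsWeight (A : Set ι) α ∧ ∑ k, α k • P k = x := by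
  rw [Geometry.SimplicialComplex.mem_space_iff]
  constructor
  · rintro ⟨s, ⟨-, A, hA, hsA⟩, hx⟩
    obtain ⟨α, hα, rfl⟩ := exists_isWeight_of_mem_convexHull (A := (A : Set ι)) (P := P)
      (fun y hy => by simpa using hsA hy) hx
    exact ⟨A, hA, α, hα.mono Set.inter_subset_left, rfl⟩
  · rintro ⟨A, hA, α, hα, rfl⟩
    have hne : A.Nonempty := by
      by_contra hA
      rw [Finset.not_nonempty_iff_eq_empty] at hA
      have := hα.sum_eq
      rw [Finset.sum_eq_zero fun k _ => hα.supp k (by simp [hA])] at this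
      exact zero_ne_one this
    exact ⟨A.image P, ⟨hne.image P, A, hA, Finset.Subset.refl _⟩,
      hα.sum_mem_convexHull fun k hk => by simpa using ⟨k, hk, rfl⟩⟩

end UniqueWeights

end Complex

end PaperTorus

namespace PaperTorus

/-! ### Triangles in the plane and in space -/

lemma exists_affineIsometry_of_triangle {x₀ x₁ x₂ : E2} {y₀ y₁ y₂ : E3}
    (hx : LinearIndependent ℝ ![x₁ - x₀, x₂ - x₀]) (h₁ : ‖y₁ - y₀‖ = ‖x₁ - x₀‖)
    (h₂ : ‖y₂ - y₀‖ = ‖x₂ - x₀‖) (h₃ : ‖y₂ - y₁‖ = ‖x₂ - x₁‖) :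
    ∃ g : E2 →ᵃⁱ[ℝ] E3, ∀ a b c : ℝ, a + b + c = 1 →
      g (a • x₀ + b • x₁ + c • x₂) = a • y₀ + b • y₁ + c • y₂ := by
  let bas := basisOfLinearIndependentOfCardEqFinrank hx (by simp)
  have hb0 : bas 0 = x₁ - x₀ := by simp [bas]
  have hb1 : bas 1 = x₂ - x₀ := by simp [bas]
  let L : E2 →ₗ[ℝ] E3 := bas.constr ℝ ![y₁ - y₀, y₂ - y₀]
  have hL0 : L (x₁ - x₀) = y₁ - y₀ := by
    rw [← hb0]; simp [L]
  have hL1 : L (x₂ - x₀) = y₂ - y₀ := by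
    rw [← hb1]; simp [L]
  have hnorm : ∀ w, ‖L w‖ = ‖w‖ := by
    intro w
    have hw : w = bas.repr w 0 • (x₁ - x₀) + bas.repr w 1 • (x₂ - x₀) := by
      rw [← hb0, ← hb1, ← Fin.sum_univ_two (fun i => bas.repr w i • bas i), bas.sum_repr]
    generalize bas.repr w 0 = s at hw
    generalize bas.repr w 1 = t at hw
    -- Polarization: the squared norm of `s • u + t • v` depends only on the three side lengths of
    -- the triangle `0`, `u`, `v`, so equal sides make `L` an isometry.
    have key : ∀ {F : Type} [NormedAddCommGroup F] [InnerProductSpace ℝ F] (u v : F),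
        ‖s • u + t • v‖ ^ 2 = s ^ 2 * ‖u‖ ^ 2 + s * t * (‖u‖ ^ 2 + ‖v‖ ^ 2 - ‖v - u‖ ^ 2)
          + t ^ 2 * ‖v‖ ^ 2 := by
      intro F _ _ u v
      rw [norm_add_sq_real, norm_sub_sq_real, norm_smul, norm_smul, inner_smul_left,
        inner_smul_right, mul_pow, mul_pow, Real.norm_eq_abs, Real.norm_eq_abs, sq_abs, sq_abs,
        real_inner_comm u v]
      simp
      ring
    have hLw : L w = s • (y₁ - y₀) + t • (y₂ - y₀) := by
      rw [hw, map_add, map_smul, map_smul, hL0, hL1]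
    rw [← sq_eq_sq₀ (norm_nonneg _) (norm_nonneg _), hLw, hw, key, key, h₁, h₂,
      sub_sub_sub_cancel_right, sub_sub_sub_cancel_right, h₃]
  refine ⟨{ toFun := fun w => L (w - x₀) + y₀, linear := L, map_vadd' := fun p v => ?_,
            norm_map := hnorm }, fun a b c habc => ?_⟩
  · simp only [vadd_eq_add]
    rw [add_sub_assoc, map_add, add_assoc]
  · change L (a • x₀ + b • x₁ + c • x₂ - x₀) + y₀ = _
    have e : a • x₀ + b • x₁ + c • x₂ - x₀ = b • (x₁ - x₀) + c • (x₂ - x₀) := by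
      have : a = 1 - b - c := by linarith
      subst this
      module
    rw [e, map_add, map_smul, map_smul, hL0, hL1]
    have : a = 1 - b - c := by linarith
    subst this
    module

/-! ### The vertex labelling of the grid by integers modulo eight -/

/-- The triangles of the triangulation of the torus with eight vertices. -/
def labelTriangles : Set (Finset (ZMod 8)) :=
  {A | ∃ l, A = {l, l + 1, l + 3} ∨ A = {l, l + 2, l + 3}}

/-- Barycentric coordinates, in terms of vertex labels, of a point of the plane. -/
noncomputable def labelWeight (z : ℝ × ℝ) : ZMod 8 → ℝ :=
  interp (fun m n => Pi.single (((m + 2 * n : ℤ)) : ZMod 8) 1) z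

lemma sum_labelWeight_smul {E : Type*} [AddCommGroup E] [Module ℝ E] (P : ZMod 8 → E)
    (z : ℝ × ℝ) : ∑ k, labelWeight z k • P k =
      interp (fun m n => P ((m + 2 * n : ℤ) : ZMod 8)) z := by
  have := map_interp (Fintype.linearCombination ℝ P)
    (fun m n => Pi.single (((m + 2 * n : ℤ)) : ZMod 8) (1 : ℝ)) z
  rw [Fintype.linearCombination_apply] at this
  rw [labelWeight, this]
  congr
  ext m n
  simp [Fintype.linearCombination_apply_single]

lemma exists_cell_coords (z : ℝ × ℝ) : ∃ (m n : ℤ) (b c : ℝ), 0 ≤ b ∧ 0 ≤ c ∧ b + c < 1 ∧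
    (z = (m + b + c, n + c) ∨ z = (m + c, n + b + c)) := by
  have h1 := Int.fract_nonneg z.1
  have h2 := Int.fract_nonneg z.2
  have h3 := Int.fract_lt_one z.1
  have h4 := Int.fract_lt_one z.2
  have h5 := Int.floor_add_fract z.1
  have h6 := Int.floor_add_fract z.2
  rcases le_total (Int.fract z.2) (Int.fract z.1) with h | h
  · exact ⟨⌊z.1⌋, ⌊z.2⌋, Int.fract z.1 - Int.fract z.2, Int.fract z.2, by linarith, h2,
      by linarith, Or.inl (Prod.ext (by simp only; linarith) (by simp only; linarith))⟩
  · exact ⟨⌊z.1⌋, ⌊z.2⌋, Int.fract z.2 - Int.fract z.1, Int.fract z.1, by linarith, h1,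
      by linarith, Or.inr (Prod.ext (by simp only; linarith) (by simp only; linarith))⟩

/-- Barycentric coordinates on the triangle with labels `l`, `l + e`, `l + 3`. -/
def triWeight (l e : ZMod 8) (b c : ℝ) : ZMod 8 → ℝ :=
  (1 - b - c) • Pi.single l 1 + b • Pi.single (l + e) 1 + c • Pi.single (l + 3) 1

lemma isWeight_triWeight (l e : ZMod 8) {b c : ℝ} (hb : 0 ≤ b) (hc : 0 ≤ c) (hbc : b + c ≤ 1) :
    IsWeight (({l, l + e, l + 3} : Finset (ZMod 8)) : Set (ZMod 8)) (triWeight l e b c) := by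
  refine ⟨fun k => ?_, ?_, fun k hk => ?_⟩
  · have h : ∀ j : ZMod 8, 0 ≤ (Pi.single j 1 : ZMod 8 → ℝ) k := fun j => by
      rw [Pi.single_apply]; split_ifs <;> norm_num
    simp only [triWeight, Pi.add_apply, Pi.smul_apply, smul_eq_mul]
    exact add_nonneg (add_nonneg (mul_nonneg (by linarith) (h _)) (mul_nonneg hb (h _)))
      (mul_nonneg hc (h _))
  · simp [triWeight, Finset.sum_add_distrib, ← Finset.mul_sum]
    ring
  · simp only [Finset.coe_insert, Finset.coe_singleton, Set.mem_insert_iff,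
      Set.mem_singleton_iff, not_or] at hk
    simp [triWeight, hk.1, hk.2.1, hk.2.2]

lemma eq_triWeight_of_isWeight {l e : ZMod 8} (he : e = 1 ∨ e = 2) {α : ZMod 8 → ℝ}
    (h : IsWeight (({l, l + e, l + 3} : Finset (ZMod 8)) : Set (ZMod 8)) α) :
    ∃ b c, 0 ≤ b ∧ 0 ≤ c ∧ b + c ≤ 1 ∧ α = triWeight l e b c := by
  have h1 : l ≠ l + e ∧ l ≠ l + 3 ∧ l + e ≠ l + 3 := by
    clear h
    rcases he with rfl | rfl <;> revert l <;> decide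
  have hsum : α l + α (l + e) + α (l + 3) = 1 := by
    rw [← h.sum_eq, ← Finset.sum_subset (Finset.subset_univ {l, l + e, l + 3})
      (fun k _ hk => h.supp k (by simpa using hk))]
    rw [Finset.sum_insert (by simp [h1]), Finset.sum_insert (by simp [h1]), Finset.sum_singleton]
    ring
  refine ⟨α (l + e), α (l + 3), h.nonneg _, h.nonneg _, by linarith [h.nonneg l], ?_⟩
  ext k
  simp only [triWeight, Pi.add_apply, Pi.smul_apply, smul_eq_mul, Pi.single_apply]
  by_cases hk0 : k = l
  · subst hk0
    simp [h1]
    linarith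
  by_cases hk1 : k = l + e
  · subst hk1
    simp [h1, hk0]
  by_cases hk2 : k = l + 3
  · subst hk2
    simp [hk0, hk1]
  · simpa [hk0, hk1, hk2] using h.supp k (by simp [hk0, hk1, hk2])

lemma labelWeight_lower (m n : ℤ) {b c : ℝ} (hb : 0 ≤ b) (hc : 0 ≤ c) (hbc : b + c ≤ 1) :
    labelWeight (m + b + c, n + c) = triWeight ((m + 2 * n : ℤ) : ZMod 8) 1 b c := by
  rw [labelWeight, interp_lower _ m n hb hc hbc, triWeight]
  congr 3 <;> congr 1 <;> push_cast <;> ring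

lemma labelWeight_upper (m n : ℤ) {b c : ℝ} (hb : 0 ≤ b) (hc : 0 ≤ c) (hbc : b + c ≤ 1) :
    labelWeight (m + c, n + b + c) = triWeight ((m + 2 * n : ℤ) : ZMod 8) 2 b c := by
  rw [labelWeight, interp_upper _ m n hb hc hbc, triWeight]
  congr 3 <;> congr 1 <;> push_cast <;> ring

/-- The strict bound `b + c < 1` gives the corner `l` positive weight, so each corner is a vertex of
the other triangle. Differences in `{0,1,2,3}` in both directions mod 8 force `l = l'`. The
exceptional case `b = 0` is the diagonal, which belongs to both triangles of a square. -/
lemma triWeight_injective {l l' e e' : ZMod 8} (he : e = 1 ∨ e = 2) (he' : e' = 1 ∨ e' = 2)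
    {b c b' c' : ℝ} (hb : 0 ≤ b) (hc : 0 ≤ c) (hbc : b + c < 1) (hb' : 0 ≤ b') (hc' : 0 ≤ c')
    (hbc' : b' + c' < 1) (h : triWeight l e b c = triWeight l' e' b' c') :
    l = l' ∧ c = c' ∧ b = b' ∧ (e = e' ∨ b = 0) := by
  have pos : ∀ {l e : ZMod 8} {b c : ℝ}, 0 ≤ b → 0 ≤ c → b + c < 1 → 0 < triWeight l e b c l := by
    intro l e b c hb hc hbc
    have h : ∀ j : ZMod 8, 0 ≤ (Pi.single j 1 : ZMod 8 → ℝ) l := fun j => by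
      rw [Pi.single_apply]; split_ifs <;> norm_num
    simp only [triWeight, Pi.add_apply, Pi.smul_apply, smul_eq_mul, Pi.single_eq_same, mul_one]
    have := mul_nonneg hb (h (l + e))
    have := mul_nonneg hc (h (l + 3))
    linarith
  have m1 : l ∈ ({l', l' + e', l' + 3} : Finset (ZMod 8)) := by
    by_contra hl
    have := (isWeight_triWeight l' e' hb' hc' hbc'.le).supp l (by simpa using hl)
    have h2 := pos (l := l) (e := e) hb hc hbc
    rw [h, this] at h2
    exact lt_irrefl _ h2
  have m2 : l' ∈ ({l, l + e, l + 3} : Finset (ZMod 8)) := by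
    by_contra hl
    have := (isWeight_triWeight l e hb hc hbc.le).supp l' (by simpa using hl)
    have h2 := pos (l := l') (e := e') hb' hc' hbc'
    rw [← h, this] at h2
    exact lt_irrefl _ h2
  have hl : l = l' := by
    clear h pos
    rcases he with rfl | rfl <;> rcases he' with rfl | rfl <;> revert l l' <;> decide
  subst hl
  have ev : ∀ k : ZMod 8, triWeight l e b c (l + k) = triWeight l e' b' c' (l + k) :=
    fun k => congrFun h _
  have hs : ∀ j k : ZMod 8, (Pi.single (l + j) 1 : ZMod 8 → ℝ) (l + k) = if k = j then 1 else 0 := by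
    intro j k
    rw [Pi.single_apply]
    simp
  have hs0 : ∀ k : ZMod 8, (Pi.single l 1 : ZMod 8 → ℝ) (l + k) = if k = 0 then 1 else 0 := by
    intro k
    rw [Pi.single_apply]
    simp
  simp only [triWeight, Pi.add_apply, Pi.smul_apply, smul_eq_mul, hs, hs0] at ev
  have e1 := ev 1
  have e2 := ev 2
  have e3 := ev 3
  have n1 : (1 : ZMod 8) ≠ 0 := by decide
  have n2 : (1 : ZMod 8) ≠ 2 := by decide
  have n3 : (1 : ZMod 8) ≠ 3 := by decide
  have n4 : (2 : ZMod 8) ≠ 0 := by decide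
  have n5 : (2 : ZMod 8) ≠ 3 := by decide
  have n6 : (3 : ZMod 8) ≠ 0 := by decide
  rcases he with rfl | rfl <;> rcases he' with rfl | rfl <;>
    simp [n1, n2, n3, n4, n5, n6, n2.symm, n3.symm, n5.symm] at e1 e2 e3 <;> simp [*]

lemma labelWeight_eq_triWeight (z : ℝ × ℝ) : ∃ (m n : ℤ) (e : ZMod 8) (b c : ℝ),
    (e = 1 ∨ e = 2) ∧ 0 ≤ b ∧ 0 ≤ c ∧ b + c < 1 ∧
    labelWeight z = triWeight ((m + 2 * n : ℤ) : ZMod 8) e b c ∧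
    (e = 1 → z = (m + b + c, n + c)) ∧ (e = 2 → z = (m + c, n + b + c)) := by
  obtain ⟨m, n, b, c, hb, hc, hbc, rfl | rfl⟩ := exists_cell_coords z
  · exact ⟨m, n, 1, b, c, Or.inl rfl, hb, hc, hbc, labelWeight_lower m n hb hc hbc.le, fun _ => rfl,
      fun h => absurd h (by decide)⟩
  · exact ⟨m, n, 2, b, c, Or.inr rfl, hb, hc, hbc, labelWeight_upper m n hb hc hbc.le,
      fun h => absurd h (by decide), fun _ => rfl⟩

lemma isWeight_labelWeight (z : ℝ × ℝ) :
    ∃ A ∈ labelTriangles, IsWeight (A : Set (ZMod 8)) (labelWeight z) := by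
  obtain ⟨m, n, e, b, c, he, hb, hc, hbc, hw, -⟩ := labelWeight_eq_triWeight z
  refine ⟨_, ⟨((m + 2 * n : ℤ) : ZMod 8), ?_⟩, hw ▸ isWeight_triWeight _ e hb hc hbc.le⟩
  rcases he with rfl | rfl
  · exact Or.inl rfl
  · exact Or.inr rfl

/-- Equal weights give equal corner labels mod 8 and the same position within the cell. The grid
vectors whose label is `0` mod 8 are exactly the `(8i - 2j, j)`. -/
lemma exists_translate_of_labelWeight_eq {z w : ℝ × ℝ} (h : labelWeight z = labelWeight w) :
    ∃ i j : ℤ, z = w + (((8 * i - 2 * j : ℤ) : ℝ), (j : ℝ)) := by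
  obtain ⟨m, n, e, b, c, he, hb, hc, hbc, hw, h1, h2⟩ := labelWeight_eq_triWeight z
  obtain ⟨m', n', e', b', c', he', hb', hc', hbc', hw', h1', h2'⟩ := labelWeight_eq_triWeight w
  rw [hw, hw'] at h
  obtain ⟨hl, rfl, rfl, hee⟩ := triWeight_injective he he' hb hc hbc hb' hc' hbc' h
  rw [ZMod.intCast_eq_intCast_iff, Int.modEq_comm, Int.modEq_iff_dvd] at hl
  obtain ⟨i, hi⟩ := hl
  refine ⟨i, n - n', ?_⟩
  have hi' : 8 * i - 2 * (n - n') = m - m' := by push_cast at hi; linarith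
  rw [hi']
  push_cast
  have hzw : z = (m + b + c, n + c) ∧ w = (m' + b + c, n' + c) ∨
      z = (m + c, n + b + c) ∧ w = (m' + c, n' + b + c) := by
    rcases hee with rfl | rfl
    · rcases he with rfl | rfl
      · exact Or.inl ⟨h1 rfl, h1' rfl⟩
      · exact Or.inr ⟨h2 rfl, h2' rfl⟩
    · left
      constructor
      · rcases he with rfl | rfl
        · exact h1 rfl
        · rw [h2 rfl]; simp
      · rcases he' with rfl | rfl
        · exact h1' rfl
        · rw [h2' rfl]; simp
  rcases hzw with ⟨rfl, rfl⟩ | ⟨rfl, rfl⟩ <;> refine Prod.ext ?_ ?_ <;> simp <;> ring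

end PaperTorus

namespace PaperTorus

/-! ### Paper tori from explicit vertices -/

section Realization

/-- The developed vertices of a flat torus: the vertex at position `(m, n)` of the grid depends
only on `m + 2 n` up to a multiple of the period `b`. -/
noncomputable def gridPos (r : ℤ → ℝ × ℝ) (b : ℝ × ℝ) (m n : ℤ) : ℝ × ℝ :=
  r (m + 2 * n) + (n : ℝ) • b

lemma gridPos_translate {r : ℤ → ℝ × ℝ} {a : ℝ × ℝ} (b : ℝ × ℝ) (hr : ∀ M, r (M + 8) = r M + a)
    (m n i j : ℤ) : gridPos r b (m + (8 * i - 2 * j)) (n + j) =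
      gridPos r b m n + ((i : ℝ) • a + (j : ℝ) • b) := by
  have h1 : ∀ M i : ℤ, r (M + 8 * i) = r M + (i : ℝ) • a := by
    intro M i
    induction i with
    | zero => simp
    | succ k ih =>
      rw [show M + 8 * ((k : ℤ) + 1) = M + 8 * k + 8 by ring, hr, ih]
      push_cast
      module
    | pred k ih =>
      have := hr (M + 8 * (-(k : ℤ) - 1))
      rw [show M + 8 * (-(k : ℤ) - 1) + 8 = M + 8 * (-k) by ring, ih] at this
      rw [← sub_eq_iff_eq_add] at this
      rw [← this]
      push_cast
      module
  unfold gridPos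
  rw [show m + (8 * i - 2 * j) + 2 * (n + j) = m + 2 * n + 8 * i by ring, h1]
  push_cast
  module

lemma card_of_mem_labelTriangles {A : Finset (ZMod 8)} (hA : A ∈ labelTriangles) : A.card = 3 := by
  obtain ⟨l, rfl | rfl⟩ := hA <;> revert l <;> decide

lemma sum_triWeight_smul {E : Type*} [AddCommGroup E] [Module ℝ E] (P : ZMod 8 → E)
    (l e : ZMod 8) (b c : ℝ) : ∑ k, triWeight l e b c k • P k =
      (1 - b - c) • P l + b • P (l + e) + c • P (l + 3) := by
  simp [triWeight, add_smul, Finset.sum_add_distrib, Pi.single_apply, ite_smul]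

lemma linearIndependent_map_pair (ψ : (ℝ × ℝ) ≃L[ℝ] E2) {u v : ℝ × ℝ}
    (h : u.1 * v.2 - u.2 * v.1 < 0) : LinearIndependent ℝ ![ψ u, ψ v] := by
  rw [LinearIndependent.pair_iff]
  intro s t hst
  rw [← map_smul, ← map_smul, ← map_add, map_eq_zero_iff ψ ψ.injective] at hst
  have h1 := congrArg Prod.fst hst
  have h2 := congrArg Prod.snd hst
  simp only [Prod.fst_add, Prod.snd_add, Prod.smul_fst, Prod.smul_snd, smul_eq_mul, Prod.fst_zero,
    Prod.snd_zero] at h1 h2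
  have hs : s * (u.1 * v.2 - u.2 * v.1) = 0 := by linear_combination v.2 * h1 - v.1 * h2
  have ht : t * (u.1 * v.2 - u.2 * v.1) = 0 := by linear_combination u.1 * h2 - u.2 * h1
  exact ⟨(mul_eq_zero.1 hs).resolve_right h.ne, (mul_eq_zero.1 ht).resolve_right h.ne⟩

variable (Λ : Submodule ℤ E2) [DiscreteTopology Λ] [IsZLattice ℝ Λ]

lemma cover_eq_iff {x y : E2} : cover Λ x = cover Λ y ↔ x - y ∈ Λ := Submodule.Quotient.eq Λ

/-- Descending a homeomorphic development of the triangulated plane to the torus. -/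
theorem isRealizedByPaperTorus_of_vertices (ψ : (ℝ × ℝ) ≃L[ℝ] E2) (r : ℤ → ℝ × ℝ) (a b : ℝ × ℝ)
    (P : ZMod 8 → E3) (hr : ∀ M, r (M + 8) = r M + a)
    (hΛ : ∀ v, ψ v ∈ Λ ↔ ∃ i j : ℤ, v = (i : ℝ) • a + (j : ℝ) • b) {c : ℝ} (hc : 0 < c)
    (ha₁ : ∀ M, (r (M + 1) - r M).1 ≤ -c) (ha₂ : ∀ M, c ≤ (r (M + 1) - r M).2)
    (hb₁ : ∀ M, c ≤ (r (M + 2) + b - r M).1) (hb₂ : ∀ M, c ≤ (r (M + 2) + b - r M).2)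
    (hl₁ : ∀ M : ℤ, ‖P (M + 1) - P M‖ = ‖ψ (r (M + 1) - r M)‖)
    (hl₂ : ∀ M : ℤ, ‖P (M + 2) - P M‖ = ‖ψ (r (M + 2) + b - r M)‖)
    (hl₃ : ∀ M : ℤ, ‖P (M + 3) - P M‖ = ‖ψ (r (M + 3) + b - r M)‖)
    (hP : UniqueWeights P labelTriangles) : IsRealizedByPaperTorus Λ 8 := by
  classical
  have hfst : ∀ z, (interp (gridPos r b) z).1 = interp (fun m n => (gridPos r b m n).1) z :=
    fun z => map_interp (LinearMap.fst ℝ ℝ ℝ) (gridPos r b) z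
  have hsnd : ∀ z, (interp (gridPos r b) z).2 = interp (fun m n => (gridPos r b m n).2) z :=
    fun z => map_interp (LinearMap.snd ℝ ℝ ℝ) (gridPos r b) z
  -- the development of the triangulated plane
  obtain ⟨f, hf⟩ := exists_homeomorph_of_rates (continuous_interp (gridPos r b)) hc
    (by
      intro s s' t hs
      have := interp_sub_le_fst (p := fun m n => (gridPos r b m n).1) (c := -c) (fun m n => by
        have := ha₁ (m + 2 * n)
        simp only [gridPos]
        rw [show m + 1 + 2 * n = m + 2 * n + 1 by ring]
        simpa using this) hs t
      rwa [← hfst, ← hfst] at this)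
    (by
      intro s t t' ht
      have := le_interp_sub_snd (p := fun m n => (gridPos r b m n).1) (c := c) (fun m n => by
        have := hb₁ (m + 2 * n)
        simp only [gridPos]
        rw [show m + 2 * (n + 1) = m + 2 * n + 2 by ring]
        simp at this ⊢
        linarith) s ht
      rwa [← hfst, ← hfst] at this)
    (by
      intro s s' t hs
      have := le_interp_sub_fst (p := fun m n => (gridPos r b m n).2) (c := c) (fun m n => by
        have := ha₂ (m + 2 * n)
        simp only [gridPos]
        rw [show m + 1 + 2 * n = m + 2 * n + 1 by ring]
        simpa using this) hs t
      rwa [← hsnd, ← hsnd] at this)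
    (by
      intro s t t' ht
      have := le_interp_sub_snd (p := fun m n => (gridPos r b m n).2) (c := c) (fun m n => by
        have := hb₂ (m + 2 * n)
        simp only [gridPos]
        rw [show m + 2 * (n + 1) = m + 2 * n + 2 by ring]
        simp at this ⊢
        linarith) s ht
      rwa [← hsnd, ← hsnd] at this)
  have hft : ∀ (z : ℝ × ℝ) (i j : ℤ), f (z + (((8 * i - 2 * j : ℤ) : ℝ), (j : ℝ))) =
      f z + ((i : ℝ) • a + (j : ℝ) • b) := by
    intro z i j
    rw [hf, interp_add_int, ← interp_add_const]
    simp only [gridPos_translate b hr]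
  -- the folded map
  let F : ℝ × ℝ → E3 := fun z => ∑ k, labelWeight z k • P k
  have hFc : Continuous F := by
    have : F = interp (fun m n => P ((m + 2 * n : ℤ) : ZMod 8)) :=
      funext fun z => sum_labelWeight_smul P z
    rw [this]
    exact continuous_interp _
  have hlt : ∀ (z : ℝ × ℝ) (i j : ℤ), labelWeight (z + (((8 * i - 2 * j : ℤ) : ℝ), (j : ℝ))) =
      labelWeight z := by
    intro z i j
    rw [labelWeight, interp_add_int, labelWeight]
    congr
    ext m n : 2
    congr 1
    push_cast
    have : (8 : ZMod 8) = 0 := by decide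
    rw [this]
    ring
  have hinj : ∀ z w, F z = F w → ∃ i j : ℤ, z = w + (((8 * i - 2 * j : ℤ) : ℝ), (j : ℝ)) := by
    intro z w h
    obtain ⟨A, hA, hzA⟩ := isWeight_labelWeight z
    obtain ⟨B, hB, hwB⟩ := isWeight_labelWeight w
    exact exists_translate_of_labelWeight_eq (hP A hA B hB _ _ hzA hwB h)
  let G : E2 → E3 := fun x => F (f.symm (ψ.symm x))
  have hGc : Continuous G := by fun_prop
  have hGf : ∀ z, G (ψ (f z)) = F z := fun z => by simp [G]
  have hG : ∀ x y, G x = G y ↔ x - y ∈ Λ := by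
    intro x y
    obtain ⟨x, rfl⟩ := ψ.surjective x
    obtain ⟨x, rfl⟩ := f.surjective x
    obtain ⟨y, rfl⟩ := ψ.surjective y
    obtain ⟨y, rfl⟩ := f.surjective y
    rw [hGf, hGf, ← map_sub, hΛ]
    constructor
    · intro h
      obtain ⟨i, j, rfl⟩ := hinj x y h
      exact ⟨i, j, by rw [hft, add_sub_cancel_left]⟩
    · rintro ⟨i, j, h⟩
      have : f x = f (y + (((8 * i - 2 * j : ℤ) : ℝ), (j : ℝ))) := by
        rw [hft, ← h, add_sub_cancel]
      simp only [F, f.injective this, hlt]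
  have hsurj : Function.Surjective (cover Λ) := Submodule.Quotient.mk_surjective Λ
  let φ : FlatTorus Λ → E3 := fun t => G (Function.surjInv hsurj t)
  have hφ : ∀ x, φ (cover Λ x) = G x := by
    intro x
    rw [hG, ← cover_eq_iff]
    exact Function.surjInv_eq hsurj _
  have hq : Topology.IsQuotientMap (cover Λ) := Submodule.isQuotientMap_mkQ Λ
  have hφc : Continuous φ := by
    rw [hq.continuous_iff]
    exact hGc.congr fun x => (hφ x).symm
  have hφi : Function.Injective φ := by
    intro s t h
    obtain ⟨x, rfl⟩ := hsurj s
    obtain ⟨y, rfl⟩ := hsurj t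
    rw [hφ, hφ, hG] at h
    exact (cover_eq_iff Λ).2 h
  have hcomp : CompactSpace (FlatTorus Λ) := by
    -- The rectangle `[0, 8] × [0, 1]` meets every orbit of the translations `(8i - 2j, j)`: the
    -- `j`-translation first normalizes the second coordinate, then the `i`-translation the first.
    have hK : IsCompact ((fun z => cover Λ (ψ (f z))) '' (Set.Icc (0 : ℝ) 8 ×ˢ Set.Icc (0 : ℝ) 1)) :=
      (isCompact_Icc.prod isCompact_Icc).image
        (hq.continuous.comp (ψ.continuous.comp f.continuous))
    refine ⟨?_⟩
    convert hK
    refine (Set.eq_univ_of_forall fun t => ?_).symm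
    obtain ⟨x, rfl⟩ := hsurj t
    obtain ⟨x, rfl⟩ := ψ.surjective x
    obtain ⟨z, rfl⟩ := f.surjective x
    have h1 := Int.floor_le z.2
    have h2 := Int.lt_floor_add_one z.2
    have h3 := Int.floor_le ((z.1 + 2 * ⌊z.2⌋) / 8)
    have h4 := Int.lt_floor_add_one ((z.1 + 2 * ⌊z.2⌋) / 8)
    rw [le_div_iff₀ (by norm_num)] at h3
    rw [div_lt_iff₀ (by norm_num)] at h4
    refine ⟨z + (((8 * (-⌊(z.1 + 2 * ⌊z.2⌋) / 8⌋) - 2 * (-⌊z.2⌋) : ℤ) : ℝ), ((-⌊z.2⌋ : ℤ) : ℝ)),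
      ⟨⟨?_, ?_⟩, ?_, ?_⟩, ?_⟩
    · simp only [Prod.fst_add]; push_cast; linarith
    · simp only [Prod.fst_add]; push_cast; linarith
    · simp only [Prod.snd_add]; push_cast; linarith
    · simp only [Prod.snd_add]; push_cast; linarith
    · simp only [cover_eq_iff]
      rw [hft, ← map_sub, hΛ]
      exact ⟨-⌊(z.1 + 2 * ⌊z.2⌋) / 8⌋, -⌊z.2⌋, by rw [add_sub_cancel_left]⟩
  have hcov : ∀ k, ∃ A ∈ labelTriangles, k ∈ A :=
    fun k => ⟨{k, k + 1, k + 3}, ⟨k, Or.inl rfl⟩, by simp⟩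
  have hpinj := hP.injective hcov
  have hvert := hP.vertices_eq_range hcov
  -- each labelled triangle has a flat model in the plane
  have htri : ∀ A ∈ labelTriangles, ∃ g : E2 →ᵃⁱ[ℝ] E3, ∀ α, IsWeight (A : Set (ZMod 8)) α →
      ∃ z, labelWeight z = α ∧ g (ψ (f z)) = ∑ k, α k • P k := by
    rintro A ⟨l, hA⟩
    -- The triangle is lifted to the grid square with lower left corner `(m, 0)`, where `m` is any
    -- integer representing the label.
    obtain ⟨m, rfl⟩ := ZMod.intCast_surjective l
    have hg0 : gridPos r b m 0 = r m := by simp [gridPos]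
    have hg3 : gridPos r b (m + 1) (0 + 1) = r (m + 3) + b := by
      simp [gridPos, show m + 1 + 2 = m + 3 by ring]
    -- An upper left vector followed by an upper right one has negative cross product. This makes
    -- both kinds of developed triangle nondegenerate.
    have hneg : ∀ {x y x' y' : ℝ}, x ≤ -c → c ≤ y → c ≤ x' → c ≤ y' → x * y' - y * x' < 0 := by
      intro x y x' y' h1 h2 h3 h4
      have := mul_pos (hc.trans_le h2) (hc.trans_le h3)
      have := mul_pos (by linarith : 0 < -x) (hc.trans_le h4)
      linarith
    have hstep : r (m + 2 + 1) - r (m + 2) = r (m + 3) - r (m + 2) := by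
      rw [show m + 2 + 1 = m + 3 by ring]
    have hstep' : r (m + 1 + 2) + b - r (m + 1) = r (m + 3) + b - r (m + 1) := by
      rw [show m + 1 + 2 = m + 3 by ring]
    have a₁ := ha₁ m
    have a₂ := ha₂ m
    have b₁ := hb₁ m
    have b₂ := hb₂ m
    rcases hA with rfl | rfl
    · have hg1 : gridPos r b (m + 1) 0 = r (m + 1) := by simp [gridPos]
      have b₁' := hb₁ (m + 1)
      have b₂' := hb₂ (m + 1)
      rw [hstep'] at b₁' b₂'
      have hlen := hl₂ (m + 1)
      rw [hstep'] at hlen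
      obtain ⟨g, hg⟩ := exists_affineIsometry_of_triangle (x₀ := ψ (r m)) (x₁ := ψ (r (m + 1)))
        (x₂ := ψ (r (m + 3) + b)) (y₀ := P m) (y₁ := P (m + 1)) (y₂ := P (m + 3))
        (by
          rw [← map_sub, ← map_sub]
          refine linearIndependent_map_pair ψ ?_
          have := hneg a₁ a₂ b₁' b₂'
          simp only [Prod.fst_sub, Prod.snd_sub, Prod.fst_add, Prod.snd_add] at this ⊢
          linarith)
        (by rw [← map_sub, hl₁]) (by rw [← map_sub, hl₃])
        (by
          rw [← map_sub, ← hlen]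
          push_cast
          rw [show (m : ZMod 8) + 1 + 2 = m + 3 by ring])
      refine ⟨g, fun α hα => ?_⟩
      obtain ⟨β, γ, hβ, hγ, hβγ, rfl⟩ := eq_triWeight_of_isWeight (Or.inl rfl) hα
      refine ⟨(m + β + γ, (0 : ℤ) + γ), by simpa using labelWeight_lower m 0 hβ hγ hβγ, ?_⟩
      rw [hf, interp_lower _ m 0 hβ hγ hβγ, hg0, hg1, hg3, sum_triWeight_smul, map_add ψ, map_add ψ,
        map_smul ψ, map_smul ψ, map_smul ψ, hg _ _ _ (by ring)]
    · have hg1 : gridPos r b m (0 + 1) = r (m + 2) + b := by simp [gridPos]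
      have a₁' := ha₁ (m + 2)
      have a₂' := ha₂ (m + 2)
      rw [hstep] at a₁' a₂'
      have hlen := hl₁ (m + 2)
      rw [hstep] at hlen
      -- Taking the vertex `m + 3` before `m + 2` keeps the orientation negative, as in the other
      -- kind of triangle.
      obtain ⟨g, hg⟩ := exists_affineIsometry_of_triangle (x₀ := ψ (r m)) (x₁ := ψ (r (m + 3) + b))
        (x₂ := ψ (r (m + 2) + b)) (y₀ := P m) (y₁ := P (m + 3)) (y₂ := P (m + 2))
        (by
          rw [← map_sub, ← map_sub]
          refine linearIndependent_map_pair ψ ?_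
          have := hneg a₁' a₂' b₁ b₂
          simp only [Prod.fst_sub, Prod.snd_sub, Prod.fst_add, Prod.snd_add] at this ⊢
          linarith)
        (by rw [← map_sub, hl₃]) (by rw [← map_sub, hl₂])
        (by
          rw [← map_sub, norm_sub_rev, ← norm_neg (ψ _), ← map_neg, neg_sub,
            add_sub_add_right_eq_sub, ← hlen]
          push_cast
          rw [show (m : ZMod 8) + 2 + 1 = m + 3 by ring])
      refine ⟨g, fun α hα => ?_⟩
      obtain ⟨β, γ, hβ, hγ, hβγ, rfl⟩ := eq_triWeight_of_isWeight (Or.inr rfl) hα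
      refine ⟨(m + γ, (0 : ℤ) + β + γ), by simpa using labelWeight_upper m 0 hβ hγ hβγ, ?_⟩
      rw [hf, interp_upper _ m 0 hβ hγ hβγ, hg0, hg1, hg3, sum_triWeight_smul, map_add ψ, map_add ψ,
        map_smul ψ, map_smul ψ, map_smul ψ, add_right_comm, hg _ _ _ (by ring), add_right_comm]
  refine ⟨hP.complex, φ, ?_, ?_, ?_, ?_, ?_, ?_⟩
  · rw [hvert]; exact Set.finite_range P
  · rw [hvert, ← Set.image_univ, Set.ncard_image_of_injective _ hpinj, Set.ncard_univ]
    simp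
  · exact (hφc.isClosedEmbedding hφi).isEmbedding
  · ext x
    rw [hP.mem_space_iff]
    constructor
    · rintro ⟨t, rfl⟩
      obtain ⟨x, rfl⟩ := hsurj t
      obtain ⟨x, rfl⟩ := ψ.surjective x
      obtain ⟨z, rfl⟩ := f.surjective x
      rw [hφ, hGf]
      obtain ⟨A, hA, hz⟩ := isWeight_labelWeight z
      exact ⟨A, hA, labelWeight z, hz, rfl⟩
    · rintro ⟨A, hA, α, hα, rfl⟩
      obtain ⟨g, hg⟩ := htri A hA
      obtain ⟨z, rfl, -⟩ := hg α hα
      exact ⟨cover Λ (ψ (f z)), by rw [hφ, hGf]⟩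
  · rintro s ⟨hs, A, hA, hsA⟩
    have hcard := card_of_mem_labelTriangles hA
    refine ⟨A.image P, ⟨hs.mono hsA, A, hA, Finset.Subset.refl _⟩, hsA, ?_⟩
    rw [Finset.card_image_of_injective _ hpinj, hcard]
  · rintro t ⟨-, A, hA, htA⟩ ht
    have hcard := card_of_mem_labelTriangles hA
    have htA' : t = A.image P := by
      refine Finset.eq_of_subset_of_card_le htA ?_
      rw [Finset.card_image_of_injective _ hpinj, hcard, ht]
    obtain ⟨g, hg⟩ := htri A hA
    have hmem : ∀ y ∈ convexHull ℝ (t : Set E3), ∃ z, g (ψ (f z)) = y ∧ F z = y := by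
      intro y hy
      obtain ⟨α, hα, rfl⟩ := exists_isWeight_of_mem_convexHull (A := (A : Set (ZMod 8))) (P := P)
        (by rw [htA', Finset.coe_image]) hy
      obtain ⟨z, hz, hz'⟩ := hg α (hα.mono Set.inter_subset_left)
      exact ⟨z, hz', by simp only [F, hz]⟩
    refine ⟨g, fun y hy => ?_, fun x hx => ?_⟩
    · obtain ⟨z, hz, -⟩ := hmem y hy
      exact ⟨_, hz⟩
    · obtain ⟨z, hz, hz'⟩ := hmem _ hx
      rw [← hz', ← g.injective hz, hφ, hGf]

end Realization

end PaperTorus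

namespace PaperTorus

/-! ### Separating planes from the signs of the quadruples of vertices -/

/-- The negatively oriented quadruples among the eight vertices, the quadruple `i < j < k < l`
being encoded by the decimal number `ijkl`. -/
def negativeQuadruples : List ℕ :=
  -- Leading zeros are dropped: `124` stands for the quadruple `0124`.
  [124, 125, 126, 127, 134, 135, 136, 137, 145, 146, 245, 246, 256, 345, 346, 356, 456, 467, 567,
    1234, 1235, 1236, 1237, 1246, 1247, 1256, 1257, 1347, 1356, 1357, 1367, 1456, 1467, 1567, 2345,
    2347, 2357, 2367, 2456, 2467, 2567, 3456, 3467, 3567]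

/-- Whether the quadruple `i < j < k < l` is positively oriented. -/
def isPositive (i j k l : ℕ) : Bool :=
  !(negativeQuadruples.contains (1000 * i + 100 * j + 10 * k + l))

/-- Whether the quadruple `i, j, k, v` is positively oriented, for `i < j < k` and any other `v`. -/
def side (i j k v : ℕ) : Bool :=
  -- Sorting `v` into place costs three, two, one or no transpositions, whence the alternating
  -- negations.
  if v < i then !isPositive v i j k
  else if v < j then isPositive i v j k
  else if v < k then !isPositive i j v k
  else isPositive i j k v

/-- The plane through the vertices `i, j, k` weakly separates the vertex lists `A` and `B`, with the
vertices of `A` that are not on the plane on the side `σ`. -/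
def separates (A B : List ℕ) (σ : Bool) (i j k : ℕ) : Bool :=
  A.all (fun v => v == i || v == j || v == k || side i j k v == σ) &&
    B.all (fun v => v == i || v == j || v == k || side i j k v == !σ)

/-- The vertices of a triangle. -/
def triList (l e : ℕ) : List ℕ := [l, (l + e) % 8, (l + 3) % 8]

/-- Some plane through three vertices weakly separates `A` and `B`. -/
def separable (A B : List ℕ) : Bool :=
  (List.range 8).any fun k => (List.range k).any fun j => (List.range j).any fun i =>
    separates A B true i j k || separates A B false i j k

/-- A vertex common to both triangles cannot lie strictly on either side, so the separating plane
has to contain it. In particular a triangle is separated from itself by its own plane. -/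
lemma separable_triList : ((List.range 8).all fun l => (List.range 8).all fun l' =>
    [1, 2].all fun e => [1, 2].all fun e' => separable (triList l e) (triList l' e')) = true := by
  decide +kernel

lemma exists_separates {l l' e e' : ℕ} (hl : l < 8) (hl' : l' < 8) (he : e = 1 ∨ e = 2)
    (he' : e' = 1 ∨ e' = 2) : ∃ i j k σ, i < j ∧ j < k ∧ k < 8 ∧
      separates (triList l e) (triList l' e') σ i j k = true := by
  have h := separable_triList
  rw [List.all_eq_true] at h
  have h := h l (List.mem_range.2 hl)
  rw [List.all_eq_true] at h
  have h := h l' (List.mem_range.2 hl')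
  rw [List.all_eq_true] at h
  have h := h e (by simpa using he)
  rw [List.all_eq_true] at h
  have h := h e' (by simpa using he')
  simp only [separable, List.any_eq_true, List.mem_range, Bool.or_eq_true] at h
  obtain ⟨k, hk, j, hj, i, hi, h | h⟩ := h
  · exact ⟨i, j, k, true, hi, hj, hk, h⟩
  · exact ⟨i, j, k, false, hi, hj, hk, h⟩

lemma exists_triList_of_mem_labelTriangles {A : Finset (ZMod 8)} (hA : A ∈ labelTriangles) :
    ∃ l < 8, ∃ e, (e = 1 ∨ e = 2) ∧ ∀ v ∈ A, v.val ∈ triList l e := by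
  obtain ⟨l, rfl | rfl⟩ := hA
  · exact ⟨l.val, ZMod.val_lt l, 1, Or.inl rfl, by revert l; decide⟩
  · exact ⟨l.val, ZMod.val_lt l, 2, Or.inr rfl, by revert l; decide⟩

/-- Barycentric coordinates are unique if the orientations of the quadruples of vertices are the
prescribed ones. -/
theorem uniqueWeights_of_orientations {E : Type*} [AddCommGroup E] [Module ℝ E] {P : ZMod 8 → E}
    {D : ℕ → ℕ → ℕ → ℕ → ℝ}
    (haff : ∀ i j k (w : ZMod 8 → ℝ), ∑ v, w v = 0 → ∑ v, w v • P v = 0 →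
      ∑ v, w v * D i j k v.val = 0)
    (h₁ : ∀ i j k v, D v i j k = -D i j k v) (h₂ : ∀ i j k v, D i v j k = D i j k v)
    (h₃ : ∀ i j k v, D i j v k = -D i j k v)
    (hpos : ∀ i j k l, i < j → j < k → k < l → l < 8 → isPositive i j k l = true → 0 < D i j k l)
    (hneg : ∀ i j k l, i < j → j < k → k < l → l < 8 → isPositive i j k l = false →
      D i j k l < 0) : UniqueWeights P labelTriangles := by
  intro A hA B hB α β hα hβ hαβ
  obtain ⟨l, hl, e, he, hAl⟩ := exists_triList_of_mem_labelTriangles hA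
  obtain ⟨l', hl', e', he', hBl⟩ := exists_triList_of_mem_labelTriangles hB
  obtain ⟨i, j, k, σ, hij, hjk, hk, hsep⟩ := exists_separates hl hl' he he'
  -- orientation of quadruples in arbitrary order
  have hside : ∀ v, v < 8 → v ≠ i → v ≠ j → v ≠ k →
      (side i j k v = true → 0 < D i j k v) ∧ (side i j k v = false → D i j k v < 0) := by
    intro v hv hvi hvj hvk
    unfold side
    split_ifs with c1 c2 c3
    · simp only [Bool.not_eq_true', Bool.not_eq_false']
      exact ⟨fun h => by linarith [hneg v i j k c1 hij hjk hk h, h₁ i j k v],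
        fun h => by linarith [hpos v i j k c1 hij hjk hk h, h₁ i j k v]⟩
    · exact ⟨fun h => by linarith [hpos i v j k (by omega) c2 hjk hk h, h₂ i j k v],
        fun h => by linarith [hneg i v j k (by omega) c2 hjk hk h, h₂ i j k v]⟩
    · simp only [Bool.not_eq_true', Bool.not_eq_false']
      exact ⟨fun h => by linarith [hneg i j v k hij (by omega) c3 hk h, h₃ i j k v],
        fun h => by linarith [hpos i j v k hij (by omega) c3 hk h, h₃ i j k v]⟩
    · exact ⟨fun h => hpos i j k v hij hjk (by omega) hv h,
        fun h => hneg i j k v hij hjk (by omega) hv h⟩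
  have hne : ∀ v, v < 8 → v ≠ i → v ≠ j → v ≠ k → D i j k v ≠ 0 := by
    intro v hv hvi hvj hvk
    have := hside v hv hvi hvj hvk
    cases h : side i j k v
    · exact (this.2 h).ne
    · exact (this.1 h).ne'
  have hz : ∀ i j k, D i j k k = 0 ∧ D i j k j = 0 ∧ D i j k i = 0 := fun i j k =>
    ⟨by linarith [h₃ i j k k], by linarith [h₂ i j k j, h₃ i j k j], by
      linarith [h₁ i j k i, h₂ i j k i]⟩
  set w : ZMod 8 → ℝ := fun v => α v - β v with hw
  have hw0 : ∑ v, w v = 0 := by simp [hw, hα.sum_eq, hβ.sum_eq]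
  have hwP : ∑ v, w v • P v = 0 := by simp [hw, sub_smul, hαβ]
  -- the coordinates outside the separating plane vanish
  simp only [separates, Bool.and_eq_true, List.all_eq_true, Bool.or_eq_true, beq_iff_eq] at hsep
  have hout : ∀ v : ZMod 8, v.val ≠ i → v.val ≠ j → v.val ≠ k → w v = 0 := by
    -- Off the plane, a vertex of `A` carries `α v ≥ 0` on the side `σ`, and a vertex of `B` carries
    -- `-β v ≤ 0` on the other side. All terms therefore have one sign, while `haff` makes their sum
    -- vanish.
    have hterm : ∀ v ∈ (Finset.univ : Finset (ZMod 8)),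
        0 ≤ (if σ then 1 else -1) * (w v * D i j k v.val) := by
      intro v _
      by_cases hvi : v.val = i
      · rw [hvi, (hz i j k).2.2]; simp
      by_cases hvj : v.val = j
      · rw [hvj, (hz i j k).2.1]; simp
      by_cases hvk : v.val = k
      · rw [hvk, (hz i j k).1]; simp
      have hs := hside v.val (ZMod.val_lt v) hvi hvj hvk
      have hsA : v ∈ A → side i j k v.val = σ := fun h => by
        simpa [hvi, hvj, hvk] using hsep.1 v.val (hAl v h)
      have hsB : v ∈ B → side i j k v.val = !σ := fun h => by
        simpa [hvi, hvj, hvk] using hsep.2 v.val (hBl v h)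
      have e1 : v ∉ A → α v = 0 := fun h => hα.supp v (by simpa using h)
      have e2 : v ∉ B → β v = 0 := fun h => hβ.supp v (by simpa using h)
      have n1 := hα.nonneg v
      have n2 := hβ.nonneg v
      by_cases hvA : v ∈ A
      · have hvB : v ∉ B := fun h => by
          have := (hsA hvA).symm.trans (hsB h)
          cases σ <;> simp at this
        simp only [hw, e2 hvB, sub_zero]
        cases σ
        · have := hs.2 (hsA hvA)
          simp only [Bool.false_eq_true, if_false]
          nlinarith
        · have := hs.1 (hsA hvA)
          simp only [if_true]
          nlinarith
      · simp only [hw, e1 hvA, zero_sub]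
        by_cases hvB : v ∈ B
        · cases σ
          · have := hs.1 (hsB hvB)
            simp only [Bool.false_eq_true, if_false]
            nlinarith
          · have := hs.2 (hsB hvB)
            simp only [if_true]
            nlinarith
        · simp [e2 hvB]
    have hsum : ∑ v, (if σ then (1 : ℝ) else -1) * (w v * D i j k v.val) = 0 := by
      rw [← Finset.mul_sum, haff i j k w hw0 hwP, mul_zero]
    intro v hvi hvj hvk
    have h0 := (Finset.sum_eq_zero_iff_of_nonneg hterm).1 hsum v (Finset.mem_univ v)
    have hσ : (if σ then (1 : ℝ) else -1) ≠ 0 := by cases σ <;> simp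
    exact (mul_eq_zero.1 ((mul_eq_zero.1 h0).resolve_left hσ)).resolve_right
      (hne v.val (ZMod.val_lt v) hvi hvj hvk)
  -- the remaining three vertices are affinely independent
  obtain ⟨l, hl8, hli, hlj, hlk⟩ : ∃ l, l < 8 ∧ l ≠ i ∧ l ≠ j ∧ l ≠ k := by
    rcases Nat.eq_zero_or_pos i with h | h
    · by_cases hj : j = 1
      · by_cases hk : k = 2
        · exact ⟨3, by omega⟩
        · exact ⟨2, by omega⟩
      · exact ⟨1, by omega⟩
    · exact ⟨0, by omega⟩
  have hD := hne l hl8 hli hlj hlk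
  -- The plane through `l` and two of the vertices `i`, `j`, `k` annihilates every term except that
  -- of the third vertex, whose weight must then be zero.
  have hlast : ∀ a b v₀, (∀ v : ZMod 8, v.val ≠ v₀ → w v * D a b l v.val = 0) → v₀ < 8 →
      D a b l v₀ ≠ 0 → ∀ v : ZMod 8, v.val = v₀ → w v = 0 := by
    intro a b v₀ h hv₀ hD' v hv
    have hs := haff a b l w hw0 hwP
    rw [Finset.sum_eq_single v (fun u _ hu => h u fun h' => hu (ZMod.val_injective 8
      (h'.trans hv.symm))) (by simp), hv] at hs
    exact (mul_eq_zero.1 hs).resolve_right hD'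
  have hrest : ∀ a b v₀, (v₀ = i ∨ v₀ = j ∨ v₀ = k) → (∀ v, v = i ∨ v = j ∨ v = k → v ≠ v₀ →
      v = a ∨ v = b) → ∀ v : ZMod 8, v.val ≠ v₀ → w v * D a b l v.val = 0 := by
    intro a b v₀ _ hab v hv
    by_cases h : v.val = i ∨ v.val = j ∨ v.val = k
    · rcases hab _ h hv with h | h
      · rw [h, (hz a b l).2.2, mul_zero]
      · rw [h, (hz a b l).2.1, mul_zero]
    · push Not at h
      rw [hout v h.1 h.2.1 h.2.2, zero_mul]
  have hi := hlast j k i (hrest j k i (Or.inl rfl) (by tauto)) (by omega)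
    (by rw [← neg_ne_zero, ← h₁ j k l i]; exact hD)
  have hj := hlast i k j (hrest i k j (by tauto) (by tauto)) (by omega)
    (by rw [← h₂ i k l j]; exact hD)
  have hk' := hlast i j k (hrest i j k (by tauto) (by tauto)) hk
    (by rw [← neg_ne_zero, ← h₃ i j l k]; exact hD)
  ext v
  rw [← sub_eq_zero]
  by_cases c1 : v.val = i
  · exact hi v c1
  by_cases c2 : v.val = j
  · exact hj v c2
  by_cases c3 : v.val = k
  · exact hk' v c3
  exact hout v c1 c2 c3

end PaperTorus

namespace PaperTorus

/-! ### The eight vertices in space -/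

/-- The cross product in the plane. -/
def cross (u v : ℝ × ℝ) : ℝ := u.1 * v.2 - u.2 * v.1

lemma cross_neg_left (u v : ℝ × ℝ) : cross (-u) v = -cross u v := by
  simp only [cross, Prod.fst_neg, Prod.snd_neg]; ring

lemma cross_neg_right (u v : ℝ × ℝ) : cross u (-v) = -cross u v := by
  simp only [cross, Prod.fst_neg, Prod.snd_neg]; ring

lemma cross_self (u : ℝ × ℝ) : cross u u = 0 := by
  simp only [cross]; ring

lemma cross_swap (u v : ℝ × ℝ) : cross v u = -cross u v := by
  simp only [cross]; ring

/-- The determinant of `q - p`, `r - p`, `s - p`, where the points of space are pairs of a point of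
the plane and a height. -/
def orient (p q r s : (ℝ × ℝ) × ℝ) : ℝ :=
  -p.2 * (cross q.1 r.1 + cross r.1 s.1 + cross s.1 q.1) +
    q.2 * (cross p.1 r.1 + cross r.1 s.1 + cross s.1 p.1) -
    r.2 * (cross p.1 q.1 + cross q.1 s.1 + cross s.1 p.1) +
    s.2 * (cross p.1 q.1 + cross q.1 r.1 + cross r.1 p.1)

/-- The vertices of the paper torus: a configuration which is symmetric under the half-turn about
the vertical axis, with heights `0`, `ε`, `2ε` and `H`. -/
def vertex (P₀ P₁ P₂ T : ℝ × ℝ) (ε H : ℝ) : ℕ → (ℝ × ℝ) × ℝ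
  -- The half-turn exchanges the labels `k` and `7 - k`. The two high vertices are `1` and `6`.
  | 0 => (P₀, 0)
  | 1 => (T, H)
  | 2 => (P₁, ε)
  | 3 => (P₂, 2 * ε)
  | 4 => (-P₂, 2 * ε)
  | 5 => (-P₁, ε)
  | 6 => (-T, H)
  | _ => (-P₀, 0)

/-- The conditions which make the eight vertices span an embedded torus. -/
structure IsTent (P₀ P₁ P₂ T : ℝ × ℝ) (ε H : ℝ) : Prop where
  -- In the corner configuration `cross P₀ P₁ = cross P₀ P₂`, and three quantities vanish: `-(cross
  -- P₀ P₁ + cross P₀ P₂ + cross P₁ P₂)`, which is twice the signed area of `P₀`, `-P₁`, `P₂`, then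
  -- `cross (P₂ - P₀) T`, and `cross (P₀ + P₁) T`. The conditions make these three positive and
  -- express closeness to the corner; the factor `1 / 10` is only slack.
  h₁ : cross P₀ P₁ < 0
  h₂ : cross P₀ P₁ - cross P₀ P₂ < -cross P₀ P₁ / 10
  h₃ : cross P₀ P₂ - cross P₀ P₁ < -cross P₀ P₁ / 10
  h₄ : cross P₀ P₁ + cross P₀ P₂ + cross P₁ P₂ < 0
  h₅ : -(cross P₀ P₁ + cross P₀ P₂ + cross P₁ P₂) < -cross P₀ P₁ / 10
  h₆ : cross P₂ T < 0
  h₇ : cross P₀ T < cross P₂ T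
  h₈ : 0 < cross P₀ T + cross P₁ T
  h₉ : cross P₂ T - cross P₀ T < -cross P₂ T / 10
  h₁₀ : cross P₀ T + cross P₁ T < -cross P₂ T / 10
  ε_pos : 0 < ε
  H_pos : 0 < H
  -- Some determinants have one of the three small areas as the coefficient of `H`. These bounds
  -- make that term dominate the terms in `ε`.
  small₁ : 100 * ε * (-cross P₀ P₁ - cross P₂ T) <
    H * -(cross P₀ P₁ + cross P₀ P₂ + cross P₁ P₂)
  small₂ : 100 * ε * (-cross P₀ P₁ - cross P₂ T) < H * (cross P₂ T - cross P₀ T)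
  small₃ : 100 * ε * (-cross P₀ P₁ - cross P₂ T) < H * (cross P₀ T + cross P₁ T)

-- Every determinant is a linear combination of products of a height, `ε` or `H`, with one of six
-- cross products. Once the area inequalities are multiplied by `ε` and by `H`, each of the 70 signs
-- is linear arithmetic.
set_option maxHeartbeats 4000000 in
lemma IsTent.orient_vertex {P₀ P₁ P₂ T : ℝ × ℝ} {ε H : ℝ} (h : IsTent P₀ P₁ P₂ T ε H)
    {i j k l : ℕ} (hij : i < j) (hjk : j < k) (hkl : k < l) (hl : l < 8) :
    (isPositive i j k l = true → 0 < orient (vertex P₀ P₁ P₂ T ε H i) (vertex P₀ P₁ P₂ T ε H j)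
      (vertex P₀ P₁ P₂ T ε H k) (vertex P₀ P₁ P₂ T ε H l)) ∧
    (isPositive i j k l = false → orient (vertex P₀ P₁ P₂ T ε H i) (vertex P₀ P₁ P₂ T ε H j)
      (vertex P₀ P₁ P₂ T ε H k) (vertex P₀ P₁ P₂ T ε H l) < 0) := by
  obtain ⟨h1, h2, h3, h4, h5, h6, h7, h8, h9, h10, hε, hH, s1, s2, s3⟩ := h
  have mul : ∀ {a b t : ℝ}, 0 < t → a < b → 0 < t * b - t * a := fun ht hab => by
    have := mul_lt_mul_of_pos_left hab ht
    linarith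
  have e1 := mul hε h1
  have e2 := mul hε h2
  have e3 := mul hε h3
  have e4 := mul hε h4
  have e5 := mul hε h5
  have e6 := mul hε h6
  have e7 := mul hε h7
  have e8 := mul hε h8
  have e9 := mul hε h9
  have e10 := mul hε h10
  have f1 := mul hH h1
  have f2 := mul hH h2
  have f3 := mul hH h3
  have f4 := mul hH h4
  have f5 := mul hH h5
  have f6 := mul hH h6
  have f7 := mul hH h7
  have f8 := mul hH h8
  have f9 := mul hH h9
  have f10 := mul hH h10
  clear mul h1 h2 h3 h4 h5 h6 h7 h8 h9 h10
  have c1 := cross_swap P₀ P₁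
  have c2 := cross_swap P₀ P₂
  have c3 := cross_swap P₁ P₂
  have c4 := cross_swap P₀ T
  have c5 := cross_swap P₁ T
  have c6 := cross_swap P₂ T
  interval_cases l <;> interval_cases k <;> interval_cases j <;> interval_cases i <;>
    (refine ⟨fun hp => ?_, fun hp => ?_⟩ <;>
      first
      | exact absurd hp (by decide)
      | (simp only [orient, vertex, cross_neg_left, cross_neg_right, cross_self, c1, c2, c3, c4, c5,
           c6]
         generalize cross P₀ P₁ = X at *
         generalize cross P₀ P₂ = Y at *
         generalize cross P₁ P₂ = Z at *
         generalize cross P₀ T = p at *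
         generalize cross P₁ T = q at *
         generalize cross P₂ T = r at *
         clear c1 c2 c3 c4 c5 c6
         linarith))

end PaperTorus

/-! ### Tents in Euclidean space are embedded -/

namespace PaperTorus

/-- Affinity in the last point is what turns an affine relation between the vertices into a relation
between determinants. -/
lemma exists_orient_eq_affine (p q r : (ℝ × ℝ) × ℝ) : ∃ cx cy ch c₀ : ℝ, ∀ s,
    orient p q r s = cx * s.1.1 + cy * s.1.2 + ch * s.2 + c₀ := by
  refine ⟨orient p q r ((1, 0), 0) - orient p q r ((0, 0), 0),
    orient p q r ((0, 1), 0) - orient p q r ((0, 0), 0),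
    orient p q r ((0, 0), 1) - orient p q r ((0, 0), 0), orient p q r ((0, 0), 0), fun s => ?_⟩
  simp only [orient, cross]
  ring

/-- Scaled coordinates of space. -/
noncomputable def toSpace (β : ℝ) (q : (ℝ × ℝ) × ℝ) : E3 := !₂[β * q.1.1, β * q.1.2, β * q.2]

lemma norm_toSpace_sub_sq (β : ℝ) (p q : (ℝ × ℝ) × ℝ) : ‖toSpace β p - toSpace β q‖ ^ 2 =
    β ^ 2 * ((p.1.1 - q.1.1) ^ 2 + (p.1.2 - q.1.2) ^ 2 + (p.2 - q.2) ^ 2) := by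
  rw [EuclideanSpace.norm_sq_eq, Fin.sum_univ_three]
  simp [toSpace]
  ring

theorem IsTent.uniqueWeights {P₀ P₁ P₂ T : ℝ × ℝ} {ε H : ℝ} (h : IsTent P₀ P₁ P₂ T ε H) {β : ℝ}
    (hβ : β ≠ 0) : UniqueWeights (fun k : ZMod 8 => toSpace β (vertex P₀ P₁ P₂ T ε H k.val))
      labelTriangles := by
  refine uniqueWeights_of_orientations (D := fun i j k l => orient (vertex P₀ P₁ P₂ T ε H i)
    (vertex P₀ P₁ P₂ T ε H j) (vertex P₀ P₁ P₂ T ε H k) (vertex P₀ P₁ P₂ T ε H l)) ?_ ?_ ?_ ?_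
    (fun i j k l hij hjk hkl hl => (h.orient_vertex hij hjk hkl hl).1)
    (fun i j k l hij hjk hkl hl => (h.orient_vertex hij hjk hkl hl).2)
  · intro i j k w hw hwP
    obtain ⟨cx, cy, ch, c₀, hc⟩ := exists_orient_eq_affine (vertex P₀ P₁ P₂ T ε H i)
      (vertex P₀ P₁ P₂ T ε H j) (vertex P₀ P₁ P₂ T ε H k)
    have hcoord : ∀ m : Fin 3,
        ∑ v, w v * toSpace β (vertex P₀ P₁ P₂ T ε H (ZMod.val v)) m = 0 := by
      intro m
      have := congrArg (fun u : E3 => u m) hwP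
      simpa using this
    have hx := hcoord 0
    have hy := hcoord 1
    have hz := hcoord 2
    simp only [toSpace, PiLp.toLp_apply, Matrix.cons_val_zero, Matrix.cons_val_one,
      Matrix.cons_val, mul_left_comm _ β, ← Finset.mul_sum, mul_eq_zero, hβ, false_or] at hx hy hz
    simp only [hc, mul_add, mul_left_comm _ cx, mul_left_comm _ cy, mul_left_comm _ ch,
      Finset.sum_add_distrib, ← Finset.mul_sum, ← Finset.sum_mul, hx, hy, hz, hw]
    simp
  all_goals
    intro i j k v
    simp only [orient, cross]
    ring

end PaperTorus

namespace PaperTorus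

/-! ### Developing the paper torus -/

/-- The squared Euclidean norm of a pair. -/
def nsq (v : ℝ × ℝ) : ℝ := v.1 ^ 2 + v.2 ^ 2

/-- The open upper left quadrant. -/
def UpperLeft (v : ℝ × ℝ) : Prop := 0 < -v.1 ∧ 0 < v.2

/-- The open upper right quadrant. -/
def UpperRight (v : ℝ × ℝ) : Prop := 0 < v.1 ∧ 0 < v.2

/-- The edge vectors of the developed triangulation point in the right directions. -/
structure IsSpread (D w₀ w₁ w₂ w₃ : ℝ × ℝ) : Prop where
  -- Up to the half-turn these are the edges whose labels differ by 1 (`a`) and by 2 (`b`). The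
  -- edges from `3` to `4` and from `7` to `8` are reversed by the half-turn, and `a₃` and `a₄` are
  -- their halves.
  a₀ : UpperLeft (w₃ - (1, 0) - w₀)
  a₁ : UpperLeft (D + w₁ - (1, 0) - w₃)
  a₂ : UpperLeft (w₂ - w₁ - (1, 0))
  a₃ : UpperLeft (-w₂)
  a₄ : UpperLeft w₀
  b₀ : UpperRight (D + w₁ - w₀)
  b₁ : UpperRight (D + w₂ - w₃)
  b₂ : UpperRight ((1, 0) - w₁ - w₂)
  b₃ : UpperRight ((1, 0) + w₀ + w₃)

/-- Corresponding edges in space and in the plane have equal lengths. -/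
structure IsFolding (D w₀ w₁ w₂ w₃ P₀ P₁ P₂ T : ℝ × ℝ) (ε H : ℝ) : Prop where
  -- Four edges join a vertex `k` to `7 - k`. Their midpoints are the four half-periods, fixed by
  -- the involution, and the `wᵢ` are half edge vectors up to sign. The remaining twenty edges form
  -- ten pairs under the half-turn.
  n₀ : nsq P₀ = nsq w₀
  n₁ : nsq P₁ = nsq w₁
  n₂ : nsq P₂ = nsq w₂
  n₃ : nsq T = nsq w₃
  a₀ : nsq (T - P₀) + H ^ 2 = nsq (w₃ - (1, 0) - w₀)
  a₁ : nsq (P₁ - T) + (H - ε) ^ 2 = nsq (D + w₁ - (1, 0) - w₃)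
  a₂ : nsq (P₂ - P₁) + ε ^ 2 = nsq (w₂ - w₁ - (1, 0))
  b₀ : nsq (P₁ - P₀) + ε ^ 2 = nsq (D + w₁ - w₀)
  b₁ : nsq (P₂ - T) + (H - 2 * ε) ^ 2 = nsq (D + w₂ - w₃)
  b₂ : nsq (P₂ + P₁) + ε ^ 2 = nsq ((1, 0) - w₁ - w₂)
  b₃ : nsq (P₀ + T) + H ^ 2 = nsq ((1, 0) + w₀ + w₃)
  d₀ : nsq (P₂ - P₀) + 4 * ε ^ 2 = nsq (D + w₂ - (1, 0) - w₀)
  d₁ : nsq (P₂ + T) + (H - 2 * ε) ^ 2 = nsq (D - w₂ - w₃)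
  d₅ : nsq (P₀ + P₁) + ε ^ 2 = nsq (D + w₀ + w₁)

/-- The first eight developed vertices along a row of the grid. -/
noncomputable def rowBase (D w₀ w₁ w₂ w₃ : ℝ × ℝ) : ℕ → ℝ × ℝ
  -- The entries `k` and `7 - k` are symmetric about the half-period `D - (3, 0)`.
  | 0 => w₀
  | 1 => w₃ - (1, 0)
  | 2 => D + w₁ - (2, 0)
  | 3 => D + w₂ - (3, 0)
  | 4 => D - w₂ - (3, 0)
  | 5 => D - w₁ - (4, 0)
  | 6 => D + D - w₃ - (5, 0)
  | _ => D + D - w₀ - (6, 0)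

/-- The developed vertices along a row of the grid. -/
noncomputable def row (D w₀ w₁ w₂ w₃ : ℝ × ℝ) (M : ℤ) : ℝ × ℝ :=
  rowBase D w₀ w₁ w₂ w₃ (M % 8).toNat + ((M / 8 : ℤ) : ℝ) • (D + D - (6, 0))

lemma row_add_eight (D w₀ w₁ w₂ w₃ : ℝ × ℝ) (M : ℤ) :
    row D w₀ w₁ w₂ w₃ (M + 8) = row D w₀ w₁ w₂ w₃ M + (D + D - (6, 0)) := by
  unfold row
  rw [Int.add_emod_right, Int.add_ediv_of_dvd_right (by norm_num)]
  push_cast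
  module

lemma forall_int_of_periodic {p : ℤ → Prop} (hp : ∀ M, p (M + 8) ↔ p M) (h0 : p 0) (h1 : p 1)
    (h2 : p 2) (h3 : p 3) (h4 : p 4) (h5 : p 5) (h6 : p 6) (h7 : p 7) (M : ℤ) : p M := by
  have key : ∀ q M : ℤ, p (M + 8 * q) ↔ p M := by
    intro q
    induction q with
    | zero => simp
    | succ k ih => intro M; rw [show M + 8 * ((k : ℤ) + 1) = M + 8 * k + 8 by ring, hp, ih]
    | pred k ih =>
      intro M
      rw [← hp, show M + 8 * (-(k : ℤ) - 1) + 8 = M + 8 * (-k) by ring, ih]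
  rw [← Int.emod_add_mul_ediv M 8, key]
  have h8 := Int.emod_nonneg M (b := 8) (by norm_num)
  have h9 := Int.emod_lt_of_pos M (b := 8) (by norm_num)
  generalize M % 8 = q at *
  interval_cases q <;> assumption

lemma exists_pos_le_of_list (L : List ℝ) (h : ∀ v ∈ L, 0 < v) : ∃ c > 0, ∀ v ∈ L, c ≤ v := by
  induction L with
  | nil => exact ⟨1, one_pos, by simp⟩
  | cons a L ih =>
    obtain ⟨c, hc, hL⟩ := ih fun v hv => h v (List.mem_cons_of_mem _ hv)
    refine ⟨min a c, lt_min (h a (by simp)) hc, fun v hv => ?_⟩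
    rcases List.mem_cons.1 hv with rfl | hv
    · exact min_le_left _ _
    · exact (min_le_right _ _).trans (hL v hv)

/-- A folding of a spread development, whose vertices form a tent, is a paper torus. -/
theorem isRealizedByPaperTorus_of_folding (Λ : Submodule ℤ E2) [DiscreteTopology Λ]
    [IsZLattice ℝ Λ] (ψ : (ℝ × ℝ) ≃L[ℝ] E2) {β : ℝ} (hβ : 0 < β)
    (hψ : ∀ v, ‖ψ v‖ ^ 2 = β ^ 2 * nsq v) {D w₀ w₁ w₂ w₃ P₀ P₁ P₂ T : ℝ × ℝ} {ε H : ℝ}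
    (hΛ : ∀ v, ψ v ∈ Λ ↔ ∃ i j : ℤ, v = (i : ℝ) • (D + D) + (j : ℝ) • (2, 0))
    (hS : IsSpread D w₀ w₁ w₂ w₃) (hF : IsFolding D w₀ w₁ w₂ w₃ P₀ P₁ P₂ T ε H)
    (hT : IsTent P₀ P₁ P₂ T ε H) : IsRealizedByPaperTorus Λ 8 := by
  have hr := row_add_eight D w₀ w₁ w₂ w₃
  have hr1 : ∀ M k, row D w₀ w₁ w₂ w₃ (M + 8 + k) = row D w₀ w₁ w₂ w₃ (M + k) + (D + D - (6, 0)) :=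
    fun M k => by rw [add_right_comm, hr]
  have hd : ∀ M k, row D w₀ w₁ w₂ w₃ (M + 8 + k) - row D w₀ w₁ w₂ w₃ (M + 8) =
      row D w₀ w₁ w₂ w₃ (M + k) - row D w₀ w₁ w₂ w₃ M :=
    fun M k => by rw [hr1, hr, add_sub_add_right_eq_sub]
  have hd' : ∀ M k v, row D w₀ w₁ w₂ w₃ (M + 8 + k) + v - row D w₀ w₁ w₂ w₃ (M + 8) =
      row D w₀ w₁ w₂ w₃ (M + k) + v - row D w₀ w₁ w₂ w₃ M :=
    fun M k v => by rw [add_sub_right_comm, hd, ← add_sub_right_comm]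
  have hrow : ∀ (M : ℤ) (k : ℕ), (M % 8).toNat = k → M / 8 = 0 →
      row D w₀ w₁ w₂ w₃ M = rowBase D w₀ w₁ w₂ w₃ k := by
    intro M k h h'
    rw [row, h, h']
    simp
  have e0 : row D w₀ w₁ w₂ w₃ 0 = w₀ := hrow _ _ rfl rfl
  have e1 : row D w₀ w₁ w₂ w₃ 1 = w₃ - (1, 0) := hrow _ _ rfl rfl
  have e2 : row D w₀ w₁ w₂ w₃ 2 = D + w₁ - (2, 0) := hrow _ _ rfl rfl
  have e3 : row D w₀ w₁ w₂ w₃ 3 = D + w₂ - (3, 0) := hrow _ _ rfl rfl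
  have e4 : row D w₀ w₁ w₂ w₃ 4 = D - w₂ - (3, 0) := hrow _ _ rfl rfl
  have e5 : row D w₀ w₁ w₂ w₃ 5 = D - w₁ - (4, 0) := hrow _ _ rfl rfl
  have e6 : row D w₀ w₁ w₂ w₃ 6 = D + D - w₃ - (5, 0) := hrow _ _ rfl rfl
  have e7 : row D w₀ w₁ w₂ w₃ 7 = D + D - w₀ - (6, 0) := hrow _ _ rfl rfl
  have e8 : row D w₀ w₁ w₂ w₃ 8 = w₀ + (D + D - (6, 0)) := (hr 0).trans (by rw [e0])
  have e9 : row D w₀ w₁ w₂ w₃ 9 = w₃ - (1, 0) + (D + D - (6, 0)) := e1 ▸ hr 1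
  have e10 : row D w₀ w₁ w₂ w₃ 10 = D + w₁ - (2, 0) + (D + D - (6, 0)) :=
    e2 ▸ hr 2
  obtain ⟨⟨a0, a0'⟩, ⟨a1, a1'⟩, ⟨a2, a2'⟩, ⟨a3, a3'⟩, ⟨a4, a4'⟩, ⟨b0, b0'⟩, ⟨b1, b1'⟩, ⟨b2, b2'⟩,
    b3, b3'⟩ := hS
  obtain ⟨c, hc, hcL⟩ := exists_pos_le_of_list [_, _, _, _, _, _, _, _, _, _, _, _, _, _, _, _, _, _]
    (by
      simp only [List.forall_mem_cons]
      exact ⟨a0, a0', a1, a1', a2, a2', a3, a3', a4, a4', b0, b0', b1, b1', b2, b2', b3, b3',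
        by simp⟩)
  simp only [List.forall_mem_cons] at hcL
  obtain ⟨a0, a0', a1, a1', a2, a2', a3, a3', a4, a4', b0, b0', b1, b1', b2, b2', b3, b3', -⟩ := hcL
  have hlen : ∀ {a b : ZMod 8} (i j : ℕ) {v : ℝ × ℝ}, a.val = i → b.val = j →
      nsq ((vertex P₀ P₁ P₂ T ε H i).1 - (vertex P₀ P₁ P₂ T ε H j).1) +
        ((vertex P₀ P₁ P₂ T ε H i).2 - (vertex P₀ P₁ P₂ T ε H j).2) ^ 2 = nsq v →
      ‖toSpace β (vertex P₀ P₁ P₂ T ε H a.val) - toSpace β (vertex P₀ P₁ P₂ T ε H b.val)‖ =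
        ‖ψ v‖ := by
    rintro a b i j v rfl rfl h
    rw [← sq_eq_sq₀ (norm_nonneg _) (norm_nonneg _), hψ, norm_toSpace_sub_sq, ← h, nsq]
    simp only [Prod.fst_sub, Prod.snd_sub]
  have hper : ∀ M : ℤ, ((M + 8 : ℤ) : ZMod 8) = M := fun M => by
    push_cast
    rw [show (8 : ZMod 8) = 0 from rfl, add_zero]
  simp only [Prod.fst_add, Prod.snd_add, Prod.fst_sub, Prod.snd_sub, Prod.fst_neg,
    Prod.snd_neg] at a0 a0' a1 a1' a2 a2' a3 a3' a4 a4' b0 b0' b1 b1' b2 b2' b3 b3'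
  obtain ⟨n0, n1, n2, n3, l0, l1, l2, l3, l4, l5, l6, l7, l8, l9⟩ := hF
  simp only [nsq] at n0 n1 n2 n3
  simp only [nsq, Prod.fst_add, Prod.snd_add, Prod.fst_sub, Prod.snd_sub] at l0 l1 l2 l3 l4
  simp only [nsq, Prod.fst_add, Prod.snd_add, Prod.fst_sub, Prod.snd_sub] at l5 l6 l7 l8 l9
  refine isRealizedByPaperTorus_of_vertices Λ ψ (row D w₀ w₁ w₂ w₃) (D + D - (6, 0)) (2, 0)
    (fun k : ZMod 8 => toSpace β (vertex P₀ P₁ P₂ T ε H k.val)) hr ?_ hc ?_ ?_ ?_ ?_ ?_ ?_ ?_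
    (hT.uniqueWeights hβ.ne')
  · intro v
    rw [hΛ]
    constructor
    · rintro ⟨i, j, rfl⟩
      -- The row period is `2D - (6, 0) = 2D - 3 • (2, 0)`, so the two pairs of generators span the
      -- same lattice.
      refine ⟨i, j + 3 * i, ?_⟩
      push_cast
      ext <;> simp <;> ring
    · rintro ⟨i, j, rfl⟩
      refine ⟨i, j - 3 * i, ?_⟩
      push_cast
      ext <;> simp <;> ring
  iterate 2
    refine forall_int_of_periodic (fun M => by rw [hd]) ?_ ?_ ?_ ?_ ?_ ?_ ?_ ?_ <;>
      norm_num [e0, e1, e2, e3, e4, e5, e6, e7, e8, e9, e10] <;> linarith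
  iterate 2
    refine forall_int_of_periodic (fun M => by rw [hd']) ?_ ?_ ?_ ?_ ?_ ?_ ?_ ?_ <;>
      norm_num [e0, e1, e2, e3, e4, e5, e6, e7, e8, e9, e10] <;> linarith
  · refine forall_int_of_periodic (fun M => by rw [hd, hper])
      (hlen 1 0 rfl rfl ?_)
      (hlen 2 1 rfl rfl ?_)
      (hlen 3 2 rfl rfl ?_)
      (hlen 4 3 rfl rfl ?_)
      (hlen 5 4 rfl rfl ?_)
      (hlen 6 5 rfl rfl ?_)
      (hlen 7 6 rfl rfl ?_)
      (hlen 0 7 rfl rfl ?_) <;>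
      simp only [vertex, nsq, zero_add, Int.reduceAdd, e0, e1, e2, e3, e4, e5, e6, e7, e8,
        Prod.fst_add, Prod.snd_add, Prod.fst_sub, Prod.snd_sub, Prod.fst_neg, Prod.snd_neg] <;>
      linarith
  · refine forall_int_of_periodic (fun M => by rw [hd', hper])
      (hlen 2 0 rfl rfl ?_)
      (hlen 3 1 rfl rfl ?_)
      (hlen 4 2 rfl rfl ?_)
      (hlen 5 3 rfl rfl ?_)
      (hlen 6 4 rfl rfl ?_)
      (hlen 7 5 rfl rfl ?_)
      (hlen 0 6 rfl rfl ?_)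
      (hlen 1 7 rfl rfl ?_) <;>
      simp only [vertex, nsq, zero_add, Int.reduceAdd, e0, e1, e2, e3, e4, e5, e6, e7, e8, e9,
        Prod.fst_add, Prod.snd_add, Prod.fst_sub, Prod.snd_sub, Prod.fst_neg, Prod.snd_neg] <;>
      linarith
  · refine forall_int_of_periodic (fun M => by rw [hd', hper])
      (hlen 3 0 rfl rfl ?_)
      (hlen 4 1 rfl rfl ?_)
      (hlen 5 2 rfl rfl ?_)
      (hlen 6 3 rfl rfl ?_)
      (hlen 7 4 rfl rfl ?_)
      (hlen 0 5 rfl rfl ?_)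
      (hlen 1 6 rfl rfl ?_)
      (hlen 2 7 rfl rfl ?_) <;>
      simp only [vertex, nsq, zero_add, Int.reduceAdd, e0, e1, e2, e3, e4, e5, e6, e7, e8, e9, e10,
        Prod.fst_add, Prod.snd_add, Prod.fst_sub, Prod.snd_sub, Prod.fst_neg, Prod.snd_neg] <;>
      linarith

end PaperTorus

namespace PaperTorus

/-! ### Solving the length equations near a degenerate folding -/

/-- The length equations, in a partially solved form. -/
lemma isFolding_of_relations {x y ε H k K₁ K₂ a₀ b₀ a₁ b₁ a₂ b₂ a₃ b₃ s t : ℝ}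
    (r₁ : a₂ = (1 - ε ^ 2) / 2)
    (r₂ : (x - 1 + ε ^ 2 * K₁) * a₂ + (y + ε ^ 2 * K₂) * b₂ =
      -((x - 1 + ε ^ 2 * K₁) ^ 2 + (y + ε ^ 2 * K₂) ^ 2) / 2)
    (r₃ : x * a₃ + y * b₃ = (x ^ 2 + y ^ 2 - (H - 2 * ε) ^ 2) / 2)
    (r₄ : (a₂ + (x - 1 + ε ^ 2 * K₁)) * s + (b₂ + (y + ε ^ 2 * K₂)) * t =
      a₂ * (a₃ - x) + b₂ * (b₃ - y))
    (r₅ : s ^ 2 + t ^ 2 = a₃ ^ 2 + b₃ ^ 2)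
    (r₆ : a₀ = (H ^ 2 - 1) / 2)
    (r₇ : (s - a₃) * a₀ + (t - b₃) * b₀ = a₃)
    (r₈ : x * a₁ + y * b₁ = (ε ^ 2 - (x ^ 2 + y ^ 2)) / 2)
    (r₉ : (s - a₃ + (x - 1)) * a₁ + (t - b₃ + y) * b₁ =
      -((x - ε ^ 2 * k * b₀) * s + (y + ε ^ 2 * k * a₀) * t) + ((x - 1) * a₃ + y * b₃) -
        ((x - 1) ^ 2 + y ^ 2) / 2 + (H - ε) ^ 2 / 2)
    (r₁₀ : (-b₀ * (a₁ + x) + a₀ * (b₁ + y)) * k = -(1 / 2 + ε ^ 2 * k ^ 2 * (a₀ ^ 2 + b₀ ^ 2) / 2))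
    (r₁₁ : (x - 1 + a₂ - a₀) * K₁ + (y + b₂ - b₀) * K₂ = -2 - ε ^ 2 * (K₁ ^ 2 + K₂ ^ 2) / 2)
    (r₁₂ : (x + a₁ - a₀) * K₁ + (y + b₁ - b₀) * K₂ =
      -2 - k * (-b₀ * (x - 1 + a₂ + ε ^ 2 * K₁) + a₀ * (y + b₂ + ε ^ 2 * K₂))) :
    IsFolding (x, y) (a₀, b₀) (a₁, b₁) (a₂, b₂) (a₃, b₃) (a₀, b₀)
      (a₁ + (x - ε ^ 2 * k * b₀), b₁ + (y + ε ^ 2 * k * a₀))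
      (a₂ + (x - 1 + ε ^ 2 * K₁), b₂ + (y + ε ^ 2 * K₂)) (s, t) ε H := by
  -- Taking `P₀ = w₀` fixes the rotation. The lengths of the edges from a vertex to `±Q` are
  -- combined by sum and difference, which leaves one condition on norms and one on inner products.
  -- Displacing `P₁` by `ε² k` times the quarter-turn of `P₀` reduces both edges from `P₁` to `±P₀`
  -- to the single equation `r₁₀`. Equations `r₁₁` and `r₁₂` govern the displacement `ε² (K₁, K₂)`
  -- of `P₂`, with a factor `ε²` divided out.
  constructor <;> simp only [nsq, Prod.fst_add, Prod.snd_add, Prod.fst_sub, Prod.snd_sub]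
  · linear_combination 2 * r₈ + 2 * ε ^ 2 * r₁₀
  · linear_combination 2 * r₂
  · exact r₅
  · linear_combination r₅ - 2 * r₆ - 2 * r₇
  · linear_combination 2 * r₈ + 2 * ε ^ 2 * r₁₀ + r₅ - 2 * r₉
  · linear_combination 2 * r₈ + 2 * ε ^ 2 * r₁₀ + 2 * r₂ + 2 * r₁ -
      2 * (r₈ + r₂ + r₁ + ε ^ 2 * (r₁₂ - r₁₁))
  · linear_combination 2 * ε ^ 2 * r₁₀
  · linear_combination 2 * r₂ + r₅ - 2 * r₄ + 2 * r₃
  · linear_combination 2 * r₈ + 2 * ε ^ 2 * r₁₀ + 2 * r₂ + 2 * r₁ +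
      2 * (r₈ + r₂ + r₁ + ε ^ 2 * (r₁₂ - r₁₁))
  · linear_combination r₅ - 2 * r₆ + 2 * r₇
  · linear_combination 2 * ε ^ 2 * r₁₁
  · linear_combination 2 * r₂ + r₅ + 2 * r₄ + 2 * r₃
  · linear_combination 2 * ε ^ 2 * r₁₀

/-- A function of `(ε, z)` which is smooth near `(0, z₀)` and takes the constant value `a` for
`ε = 0`. -/
def IsAdmissible {E : Type*} [NormedAddCommGroup E] [NormedSpace ℝ E] (z₀ : E) (u : ℝ × E → ℝ)
    (a : ℝ) : Prop :=
  ContDiffAt ℝ 1 u (0, z₀) ∧ ∀ z, u (0, z) = a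

namespace IsAdmissible

variable {E : Type*} [NormedAddCommGroup E] [NormedSpace ℝ E] {z₀ : E} {u v : ℝ × E → ℝ} {a b : ℝ}

lemma const (a : ℝ) : IsAdmissible z₀ (fun _ => a) a := ⟨contDiffAt_const, fun _ => rfl⟩

lemma fst : IsAdmissible z₀ (fun q : ℝ × E => q.1) 0 := ⟨contDiffAt_fst, fun _ => rfl⟩

lemma add (hu : IsAdmissible z₀ u a) (hv : IsAdmissible z₀ v b) :
    IsAdmissible z₀ (fun q => u q + v q) (a + b) :=
  ⟨hu.1.add hv.1, fun z => by simp only [hu.2, hv.2]⟩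

lemma sub (hu : IsAdmissible z₀ u a) (hv : IsAdmissible z₀ v b) :
    IsAdmissible z₀ (fun q => u q - v q) (a - b) :=
  ⟨hu.1.sub hv.1, fun z => by simp only [hu.2, hv.2]⟩

lemma neg (hu : IsAdmissible z₀ u a) : IsAdmissible z₀ (fun q => -u q) (-a) :=
  ⟨hu.1.neg, fun z => by simp only [hu.2]⟩

lemma mul (hu : IsAdmissible z₀ u a) (hv : IsAdmissible z₀ v b) :
    IsAdmissible z₀ (fun q => u q * v q) (a * b) :=
  ⟨hu.1.mul hv.1, fun z => by simp only [hu.2, hv.2]⟩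

lemma pow (hu : IsAdmissible z₀ u a) (n : ℕ) : IsAdmissible z₀ (fun q => u q ^ n) (a ^ n) :=
  ⟨hu.1.pow n, fun z => by simp only [hu.2]⟩

lemma div (hu : IsAdmissible z₀ u a) (hv : IsAdmissible z₀ v b) (hb : b ≠ 0) :
    IsAdmissible z₀ (fun q => u q / v q) (a / b) :=
  ⟨hu.1.div hv.1 (by rwa [hv.2]), fun z => by simp only [hu.2, hv.2]⟩

lemma div_const (hu : IsAdmissible z₀ u a) (c : ℝ) : IsAdmissible z₀ (fun q => u q / c) (a / c) :=
  ⟨hu.1.div_const c, fun z => by simp only [hu.2]⟩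

/-- The displacement parameters enter the other equations only through such products, so at `ε = 0`
those equations do not see `z`. -/
lemma sq_mul (hu : ContDiffAt ℝ 1 u (0, z₀)) : IsAdmissible z₀ (fun q => q.1 ^ 2 * u q) 0 :=
  ⟨(contDiffAt_fst.pow 2).mul hu, fun z => by simp⟩

lemma congr_val (hu : IsAdmissible z₀ u a) (h : a = b) : IsAdmissible z₀ u b := h ▸ hu

lemma continuousAt (hu : IsAdmissible z₀ u a) : ContinuousAt u (0, z₀) := hu.1.continuousAt

lemma eventually_ne (hu : IsAdmissible z₀ u a) (ha : a ≠ 0) : ∀ᶠ q in nhds (0, z₀), u q ≠ 0 :=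
  hu.continuousAt.eventually_ne (by rwa [hu.2])

/-- Solving a linear equation with admissible coefficients. -/
lemma exists_solution (hu : IsAdmissible z₀ u a) (hv : IsAdmissible z₀ v b) (ha : a ≠ 0) {c : ℝ}
    (hc : a * c = b) : ∃ w, IsAdmissible z₀ w c ∧ ∀ᶠ q in nhds (0, z₀), u q * w q = v q := by
  refine ⟨fun q => v q / u q, (hv.div hu ha).congr_val (by rw [← hc]; field_simp), ?_⟩
  filter_upwards [hu.eventually_ne ha] with q hq
  field_simp

/-- Solving a system of two linear equations with admissible coefficients. -/
lemma exists_solution₂ {u₁₁ u₁₂ u₂₁ u₂₂ v₁ v₂ : ℝ × E → ℝ} {a₁₁ a₁₂ a₂₁ a₂₂ b₁ b₂ : ℝ}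
    (h₁₁ : IsAdmissible z₀ u₁₁ a₁₁) (h₁₂ : IsAdmissible z₀ u₁₂ a₁₂) (h₁ : IsAdmissible z₀ v₁ b₁)
    (h₂₁ : IsAdmissible z₀ u₂₁ a₂₁) (h₂₂ : IsAdmissible z₀ u₂₂ a₂₂) (h₂ : IsAdmissible z₀ v₂ b₂)
    (hdet : a₁₁ * a₂₂ - a₁₂ * a₂₁ ≠ 0) {c₁ c₂ : ℝ} (hc₁ : a₁₁ * c₁ + a₁₂ * c₂ = b₁)
    (hc₂ : a₂₁ * c₁ + a₂₂ * c₂ = b₂) :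
    ∃ w₁ w₂, IsAdmissible z₀ w₁ c₁ ∧ IsAdmissible z₀ w₂ c₂ ∧ ∀ᶠ q in nhds (0, z₀),
      u₁₁ q * w₁ q + u₁₂ q * w₂ q = v₁ q ∧ u₂₁ q * w₁ q + u₂₂ q * w₂ q = v₂ q := by
  have hd := (h₁₁.mul h₂₂).sub (h₁₂.mul h₂₁)
  obtain ⟨w₁, hw₁, hq₁⟩ := hd.exists_solution ((h₁.mul h₂₂).sub (h₁₂.mul h₂)) hdet (c := c₁)
    (by rw [← hc₁, ← hc₂]; ring)
  obtain ⟨w₂, hw₂, hq₂⟩ := hd.exists_solution ((h₁₁.mul h₂).sub (h₁.mul h₂₁)) hdet (c := c₂)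
    (by rw [← hc₁, ← hc₂]; ring)
  refine ⟨w₁, w₂, hw₁, hw₂, ?_⟩
  filter_upwards [hq₁, hq₂, hd.eventually_ne hdet] with q e₁ e₂ hne
  constructor
  · refine mul_left_cancel₀ hne ?_
    linear_combination u₁₁ q * e₁ + u₁₂ q * e₂
  · refine mul_left_cancel₀ hne ?_
    linear_combination u₂₁ q * e₁ + u₂₂ q * e₂

end IsAdmissible

/-- A family of maps `G ε`, smooth near `(0, z₀)` and with `G 0` constantly equal to `z₀`, has fixed
points near `z₀` for all small `ε`. -/
lemma exists_fixed_point {E : Type*} [NormedAddCommGroup E] [NormedSpace ℝ E] [CompleteSpace E]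
    {z₀ : E} {G : ℝ × E → E} (hG : ContDiffAt ℝ 1 G (0, z₀)) (hG₀ : ∀ z, G (0, z) = z₀)
    {p : ℝ × E → Prop} (hp : ∀ᶠ q in nhds (0, z₀), p q) :
    ∀ᶠ ε in nhds (0 : ℝ), ∃ z, G (ε, z) = z ∧ p (ε, z) := by
  have hs := hG.hasStrictFDerivAt one_ne_zero
  set G' := fderiv ℝ G (0, z₀)
  -- Since `G 0` is constant, the derivative of `G` in `z` vanishes at `(0, z₀)`. Hence `(ε, z) ↦
  -- (ε, z - G (ε, z))` has surjective strict derivative, is open at this point, and takes the value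
  -- `(ε, 0)` for every small `ε`.
  have hz : ∀ z, G' (0, z) = 0 := by
    have h1 : HasFDerivAt (fun z => G (0, z)) (G'.comp (ContinuousLinearMap.inr ℝ ℝ E)) z₀ :=
      HasFDerivAt.comp z₀ hs.hasFDerivAt (hasFDerivAt_prodMk_right (0 : ℝ) z₀)
    have h2 : HasFDerivAt (fun z => G (0, z)) (0 : E →L[ℝ] E) z₀ := by
      simp only [hG₀]
      exact hasFDerivAt_const z₀ z₀
    intro z
    have := congrArg (fun L : E →L[ℝ] E => L z) (h1.unique h2)
    simpa using this
  have hF : HasStrictFDerivAt (fun q : ℝ × E => (q.1, q.2 - G q))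
      ((ContinuousLinearMap.fst ℝ ℝ E).prod (ContinuousLinearMap.snd ℝ ℝ E - G')) (0, z₀) :=
    hasStrictFDerivAt_fst.prodMk (hasStrictFDerivAt_snd.sub hs)
  have hsurj : ((ContinuousLinearMap.fst ℝ ℝ E).prod
      (ContinuousLinearMap.snd ℝ ℝ E - G')).range = ⊤ := by
    rw [LinearMap.range_eq_top]
    rintro ⟨ε, w⟩
    refine ⟨(ε, w + G' (ε, 0)), ?_⟩
    have : G' (ε, w + G' (ε, 0)) = G' (ε, 0) := by
      have h3 : ((ε, w + G' (ε, 0)) : ℝ × E) = (ε, 0) + (0, w + G' (ε, 0)) := by simp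
      rw [h3, map_add, hz, add_zero]
    simp [this]
  have hmap := hF.map_nhds_eq_of_surj hsurj
  have h0 : ((0 : ℝ), z₀ - G (0, z₀)) = (0, 0) := by rw [hG₀, sub_self]
  simp only [h0] at hmap
  have himg : ∀ᶠ w in nhds ((0 : ℝ), (0 : E)), ∃ q : ℝ × E, p q ∧ (q.1, q.2 - G q) = w := by
    rw [← hmap, Filter.eventually_map]
    filter_upwards [hp] with q hq
    exact ⟨q, hq, rfl⟩
  have hc : Filter.Tendsto (fun ε : ℝ => (ε, (0 : E))) (nhds 0) (nhds (0, 0)) :=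
    (continuous_id.prodMk continuous_const).tendsto 0
  filter_upwards [hc.eventually himg] with ε ⟨⟨ε', z⟩, hq, he⟩
  simp only [Prod.mk.injEq] at he
  obtain ⟨rfl, he⟩ := he
  exact ⟨z, (sub_eq_zero.1 he).symm, hq⟩

end PaperTorus

/-! ### Perturbing a flat folding to positive `ε` -/

namespace PaperTorus

/-- A folding with base vertices at height zero, and satisfying some non-degeneracy conditions, can
be perturbed so that the heights become `0`, `ε`, `2ε` and `H`. The perturbed folding has any given
open property of the original one. -/
theorem exists_folding_of_flat {x y H a₀ b₀ a₁ b₁ a₂ b₂ a₃ b₃ s t : ℝ} (hy : y ≠ 0) (hH : H ≠ 0)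
    (t₁ : a₂ = 1 / 2) (t₂ : (x - 1) * a₂ + y * b₂ = -((x - 1) ^ 2 + y ^ 2) / 2)
    (t₃ : x * a₃ + y * b₃ = (x ^ 2 + y ^ 2 - H ^ 2) / 2) (t₄ : s ^ 2 + t ^ 2 = a₃ ^ 2 + b₃ ^ 2)
    (t₅ : (a₂ + (x - 1)) * s + (b₂ + y) * t = a₂ * (a₃ - x) + b₂ * (b₃ - y))
    (t₆ : a₀ = (H ^ 2 - 1) / 2) (t₇ : (s - a₃) * a₀ + (t - b₃) * b₀ = a₃)
    (t₈ : x * a₁ + y * b₁ = -(x ^ 2 + y ^ 2) / 2)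
    (t₉ : (s - a₃ + (x - 1)) * a₁ + (t - b₃ + y) * b₁ =
      -(x * s + y * t) + ((x - 1) * a₃ + y * b₃) - ((x - 1) ^ 2 + y ^ 2) / 2 + H ^ 2 / 2)
    (n₁ : x * a₂ + y * b₂ ≠ 0) (n₂ : t - b₃ ≠ 0)
    (n₃ : x * (t - b₃ + y) - y * (s - a₃ + (x - 1)) ≠ 0)
    (n₄ : -b₀ * (a₁ + x) + a₀ * (b₁ + y) ≠ 0)
    (n₅ : (x - 1 + a₂ - a₀) * (y + b₁ - b₀) - (y + b₂ - b₀) * (x + a₁ - a₀) ≠ 0)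
    {Q : (ℝ × ℝ) × (ℝ × ℝ) × (ℝ × ℝ) × (ℝ × ℝ) × (ℝ × ℝ) × (ℝ × ℝ) × (ℝ × ℝ) × (ℝ × ℝ) × ℝ → Prop}
    (hQ : ∀ᶠ c in nhds ((a₀, b₀), (a₁, b₁), (a₂, b₂), (a₃, b₃), (a₀, b₀), (a₁ + x, b₁ + y),
      (a₂ + (x - 1), b₂ + y), (s, t), 0), Q c) :
    ∀ᶠ ε in nhds (0 : ℝ), ∃ w₀ w₁ w₂ w₃ P₀ P₁ P₂ T,
      IsFolding (x, y) w₀ w₁ w₂ w₃ P₀ P₁ P₂ T ε H ∧ Q (w₀, w₁, w₂, w₃, P₀, P₁, P₂, T, ε) := by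
  have hR : a₂ ^ 2 + b₂ ^ 2 ≠ 0 := by
    rw [t₁]; positivity
  have hR' : (a₂ + (x - 1)) ^ 2 + (b₂ + y) ^ 2 = a₂ ^ 2 + b₂ ^ 2 := by linear_combination 2 * t₂
  -- With `X = w₃ - D`, the vector `T` has the same inner and cross products with `P₂` as `X` plus
  -- `m` times the quarter-turn of `w₂` has with `w₂`. As `|P₂| = |w₂|`, the quadratic equation `|T|
  -- = |w₃|` becomes `hmH`. Freezing `m` at its value for `ε = 0` uses up the one spare degree of
  -- freedom and makes this equation linear in `X`.
  obtain ⟨m, hm⟩ : ∃ m, (a₂ + (x - 1)) * t - (b₂ + y) * s =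
      a₂ * (b₃ - y) - b₂ * (a₃ - x) + m * (a₂ ^ 2 + b₂ ^ 2) :=
    ⟨((a₂ + (x - 1)) * t - (b₂ + y) * s - (a₂ * (b₃ - y) - b₂ * (a₃ - x))) / (a₂ ^ 2 + b₂ ^ 2), by
      field_simp; ring⟩
  have hmH : 2 * m * (a₂ * (b₃ - y) - b₂ * (a₃ - x)) + m ^ 2 * (a₂ ^ 2 + b₂ ^ 2) + H ^ 2 = 0 := by
    refine (mul_eq_zero.1 ?_).resolve_left hR
    have e1 : ((a₂ + (x - 1)) * t - (b₂ + y) * s) ^ 2 + ((a₂ + (x - 1)) * s + (b₂ + y) * t) ^ 2 =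
        (a₂ ^ 2 + b₂ ^ 2) * (a₃ ^ 2 + b₃ ^ 2) := by
      rw [← hR', ← t₄]; ring
    rw [hm, t₅] at e1
    linear_combination e1 + 2 * (a₂ ^ 2 + b₂ ^ 2) * t₃
  have hm0 : m ≠ 0 := by
    rintro rfl
    apply hH
    nlinarith
  -- The numbers `k₀`, `K₁₀`, `K₂₀` solve the displacement equations at `ε = 0`. They are the point
  -- around which the fixed point is sought.
  obtain ⟨k₀, hk₀⟩ : ∃ k₀, (-b₀ * (a₁ + x) + a₀ * (b₁ + y)) * k₀ = -(1 / 2) :=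
    ⟨-(1 / 2) / (-b₀ * (a₁ + x) + a₀ * (b₁ + y)), mul_div_cancel₀ _ n₄⟩
  obtain ⟨K₁₀, K₂₀, hK₁₀, hK₂₀⟩ : ∃ K₁ K₂,
      (x - 1 + a₂ - a₀) * K₁ + (y + b₂ - b₀) * K₂ = -2 ∧
      (x + a₁ - a₀) * K₁ + (y + b₁ - b₀) * K₂ =
        -2 - k₀ * (-b₀ * (x - 1 + a₂) + a₀ * (y + b₂)) := by
    generalize -2 - k₀ * (-b₀ * (x - 1 + a₂) + a₀ * (y + b₂)) = e at *
    generalize x - 1 + a₂ - a₀ = p at *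
    generalize y + b₂ - b₀ = p' at *
    generalize x + a₁ - a₀ = q at *
    generalize y + b₁ - b₀ = q' at *
    exact ⟨(-2 * q' - p' * e) / (p * q' - p' * q), (p * e - -2 * q) / (p * q' - p' * q),
      by rw [← mul_div_assoc, ← mul_div_assoc, ← add_div, div_eq_iff n₅]; ring,
      by rw [← mul_div_assoc, ← mul_div_assoc, ← add_div, div_eq_iff n₅]; ring⟩
  set z₀ : ℝ × ℝ × ℝ := (k₀, K₁₀, K₂₀) with hz₀
  have ck : ContDiffAt ℝ 1 (fun q : ℝ × ℝ × ℝ × ℝ => q.2.1) (0, z₀) := by fun_prop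
  have cK₁ : ContDiffAt ℝ 1 (fun q : ℝ × ℝ × ℝ × ℝ => q.2.2.1) (0, z₀) := by fun_prop
  have cK₂ : ContDiffAt ℝ 1 (fun q : ℝ × ℝ × ℝ × ℝ => q.2.2.2) (0, z₀) := by fun_prop
  have cst : ∀ c : ℝ, IsAdmissible z₀ (fun _ => c) c := IsAdmissible.const
  have eps : IsAdmissible z₀ (fun q => q.1) 0 := IsAdmissible.fst
  have dl := ((cst H).sub ((cst 2).mul eps)).pow 2
  have cx := (cst (x - 1)).add (IsAdmissible.sq_mul cK₁)
  have cy := (cst y).add (IsAdmissible.sq_mul cK₂)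
  obtain ⟨w₂x, w₂y, hw₂x, hw₂y, hw₂⟩ := (cst 1).exists_solution₂ (cst 0)
    (((cst 1).sub (eps.pow 2)).div_const 2) cx cy (((cx.pow 2).add (cy.pow 2)).neg.div_const 2)
    (by simpa using hy) (c₁ := a₂) (c₂ := b₂) (by rw [t₁]; norm_num)
    (by linear_combination t₂)
  obtain ⟨X₁, X₂, hX₁, hX₂, hX⟩ := (cst x).exists_solution₂ (cst y)
    (((cst (x ^ 2 + y ^ 2)).add dl).neg.div_const 2) hw₂y.neg hw₂x
    ((dl.add ((cst (m ^ 2)).mul ((hw₂x.pow 2).add (hw₂y.pow 2)))).neg.div_const (2 * m))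
    (by rw [mul_neg, sub_neg_eq_add]; exact n₁) (c₁ := a₃ - x) (c₂ := b₃ - y)
    (by linear_combination t₃)
    (by rw [eq_div_iff (by simpa using hm0)]; linear_combination hmH)
  have px := hw₂x.add cx
  have py := hw₂y.add cy
  have Y₁ := hX₁.sub ((cst m).mul hw₂y)
  have Y₂ := hX₂.add ((cst m).mul hw₂x)
  -- Here `T` is recovered from its inner and cross products with `P₂`.
  obtain ⟨T₁, T₂, hT₁, hT₂, hT⟩ := px.exists_solution₂ py
    ((hw₂x.mul Y₁).add (hw₂y.mul Y₂)) py.neg px ((hw₂x.mul Y₂).sub (hw₂y.mul Y₁))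
    (by
      have : (a₂ + (x - 1)) ^ 2 + (b₂ + y) ^ 2 ≠ 0 := hR' ▸ hR
      intro h
      apply this
      linear_combination h)
    (c₁ := s) (c₂ := t) (by linear_combination t₅) (by linear_combination hm)
  have w₃x := hX₁.add (cst x)
  have w₃y := hX₂.add (cst y)
  obtain ⟨w₀x, w₀y, hw₀x, hw₀y, hw₀⟩ := (cst 1).exists_solution₂ (cst 0)
    (cst ((H ^ 2 - 1) / 2)) (hT₁.sub w₃x) (hT₂.sub w₃y) w₃x
    (by
      rw [one_mul, zero_mul, sub_zero, sub_add_cancel]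
      exact n₂) (c₁ := a₀) (c₂ := b₀) (by rw [t₆]; ring) (by linear_combination t₇)
  have kb := IsAdmissible.sq_mul (ck.mul hw₀y.1)
  have ka := IsAdmissible.sq_mul (ck.mul hw₀x.1)
  obtain ⟨w₁x, w₁y, hw₁x, hw₁y, hw₁⟩ := (cst x).exists_solution₂ (cst y)
    (((eps.pow 2).sub (cst (x ^ 2 + y ^ 2))).div_const 2)
    ((hT₁.sub w₃x).add (cst (x - 1))) ((hT₂.sub w₃y).add (cst y))
    ((((((cst x).sub kb).mul hT₁).add (((cst y).add ka).mul hT₂)).neg.add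
      (((cst (x - 1)).mul w₃x).add ((cst y).mul w₃y))).sub (cst (((x - 1) ^ 2 + y ^ 2) / 2)) |>.add
      ((((cst H).sub eps).pow 2).div_const 2))
    (by rw [sub_add_cancel, sub_add_cancel]; exact n₃) (c₁ := a₁) (c₂ := b₁)
    (by linear_combination t₈) (by linear_combination t₉)
  obtain ⟨kf, hkf, hk⟩ := ((hw₀y.neg.mul (hw₁x.add (cst x))).add
    (hw₀x.mul (hw₁y.add (cst y)))).exists_solution
    ((cst (1 / 2)).add (IsAdmissible.sq_mul ((ck.pow 2).mul
      (((hw₀x.pow 2).add (hw₀y.pow 2)).div_const 2).1))).neg n₄ (c := k₀)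
    (by rw [hk₀, add_zero])
  obtain ⟨Kf₁, Kf₂, hKf₁, hKf₂, hK⟩ := (((cst (x - 1)).add hw₂x).sub hw₀x).exists_solution₂
    (((cst y).add hw₂y).sub hw₀y)
    ((cst (-2)).sub (IsAdmissible.sq_mul (((cK₁.pow 2).add (cK₂.pow 2)).div_const 2)))
    (((cst x).add hw₁x).sub hw₀x) (((cst y).add hw₁y).sub hw₀y)
    ((cst (-2)).sub (hkf.mul ((hw₀y.neg.mul (((cst (x - 1)).add hw₂x).add
      (IsAdmissible.sq_mul cK₁))).add (hw₀x.mul (((cst y).add hw₂y).add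
      (IsAdmissible.sq_mul cK₂)))))) n₅ (c₁ := K₁₀) (c₂ := K₂₀) (by rw [hK₁₀, sub_zero])
    (by rw [hK₂₀, add_zero, add_zero])
  have hcont : ContinuousAt (fun q : ℝ × ℝ × ℝ × ℝ => ((w₀x q, w₀y q), (w₁x q, w₁y q),
      (w₂x q, w₂y q), (X₁ q + x, X₂ q + y), (w₀x q, w₀y q),
      (w₁x q + (x - q.1 ^ 2 * q.2.1 * w₀y q), w₁y q + (y + q.1 ^ 2 * q.2.1 * w₀x q)),
      (w₂x q + (x - 1 + q.1 ^ 2 * q.2.2.1), w₂y q + (y + q.1 ^ 2 * q.2.2.2)), (T₁ q, T₂ q), q.1))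
      (0, z₀) := by
    have := hw₀x.continuousAt
    have := hw₀y.continuousAt
    have := hw₁x.continuousAt
    have := hw₁y.continuousAt
    have := hw₂x.continuousAt
    have := hw₂y.continuousAt
    have := hX₁.continuousAt
    have := hX₂.continuousAt
    have := hT₁.continuousAt
    have := hT₂.continuousAt
    fun_prop
  have hev := hcont.eventually (p := Q) (by
    simpa [hw₀x.2, hw₀y.2, hw₁x.2, hw₁y.2, hw₂x.2, hw₂y.2, hX₁.2, hX₂.2, hT₁.2, hT₂.2] using hQ)
  -- All unknowns were solved with the displacements `(k, K₁, K₂)` as free parameters. A fixed point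
  -- makes these agree with the displacements that the last equations return.
  have hfix := exists_fixed_point (z₀ := z₀) (G := fun q => (kf q, Kf₁ q, Kf₂ q))
    (hkf.1.prodMk (hKf₁.1.prodMk hKf₂.1)) (fun z => by simp only [hkf.2, hKf₁.2, hKf₂.2, hz₀])
    (hev.and (hw₂.and (hX.and (hT.and (hw₀.and (hw₁.and (hk.and (hK.and
      (hw₂x.eventually_ne (by rw [t₁]; norm_num))))))))))
  filter_upwards [hfix] with ε ⟨⟨k, K₁, K₂⟩, hG, hq, ⟨e₁, e₂⟩, ⟨e₃, e₄⟩, ⟨e₅, e₆⟩, ⟨e₇, e₈⟩, ⟨e₉, e₁₀⟩,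
    e₁₁, ⟨e₁₂, e₁₃⟩, hne⟩
  simp only [Prod.mk.injEq] at hG
  obtain ⟨hG₁, hG₂, hG₃⟩ := hG
  refine ⟨_, _, _, _, _, _, _, _, ?_, hq⟩
  simp only [hG₁, hG₂, hG₃] at e₁ e₂ e₃ e₄ e₅ e₆ e₇ e₈ e₉ e₁₀ e₁₁ e₁₂ e₁₃ ⊢
  rw [eq_div_iff (by simpa using hm0)] at e₄
  generalize w₂x (ε, k, K₁, K₂) = A₂ at *
  generalize w₂y (ε, k, K₁, K₂) = B₂ at *
  generalize X₁ (ε, k, K₁, K₂) = U at *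
  generalize X₂ (ε, k, K₁, K₂) = V at *
  generalize T₁ (ε, k, K₁, K₂) = S' at *
  generalize T₂ (ε, k, K₁, K₂) = T' at *
  generalize w₀x (ε, k, K₁, K₂) = A₀ at *
  generalize w₀y (ε, k, K₁, K₂) = B₀ at *
  generalize w₁x (ε, k, K₁, K₂) = A₁ at *
  generalize w₁y (ε, k, K₁, K₂) = B₁ at *
  have hn : (A₂ + (x - 1 + ε ^ 2 * K₁)) ^ 2 + (B₂ + (y + ε ^ 2 * K₂)) ^ 2 = A₂ ^ 2 + B₂ ^ 2 := by
    linear_combination 2 * e₂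
  refine isFolding_of_relations ?_ ?_ ?_ ?_ ?_ ?_ ?_ ?_ ?_ ?_ ?_ ?_
  · linear_combination e₁
  · linear_combination e₂
  · linear_combination e₃
  · linear_combination e₅
  · have hne' : A₂ ^ 2 + B₂ ^ 2 ≠ 0 := by positivity
    refine mul_left_cancel₀ hne' ?_
    have f1 : (A₂ ^ 2 + B₂ ^ 2) * (S' ^ 2 + T' ^ 2) =
        (A₂ ^ 2 + B₂ ^ 2) * ((U - m * B₂) ^ 2 + (V + m * A₂) ^ 2) := by
      rw [← hn]
      have : ((A₂ + (x - 1 + ε ^ 2 * K₁)) ^ 2 + (B₂ + (y + ε ^ 2 * K₂)) ^ 2) * (S' ^ 2 + T' ^ 2) =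
          ((A₂ + (x - 1 + ε ^ 2 * K₁)) * S' + (B₂ + (y + ε ^ 2 * K₂)) * T') ^ 2 +
          (-(B₂ + (y + ε ^ 2 * K₂)) * S' + (A₂ + (x - 1 + ε ^ 2 * K₁)) * T') ^ 2 := by ring
      rw [this, e₅, e₆, hn]
      ring
    linear_combination f1 + (A₂ ^ 2 + B₂ ^ 2) * (e₄ - 2 * e₃)
  · linear_combination e₇
  · linear_combination e₈
  · linear_combination e₉
  · linear_combination e₁₀
  · linear_combination e₁₁
  · linear_combination e₁₂
  · linear_combination e₁₃

end PaperTorus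

/-! ### Flat tents and the corner configuration -/

namespace PaperTorus

open Filter Topology

lemma eventually_pos_of_continuousAt {X : Type*} [TopologicalSpace X] {F : X → ℝ} {a : X}
    (hF : ContinuousAt F a) (h : 0 < F a) : ∀ᶠ c in 𝓝 a, 0 < F c :=
  hF.eventually (lt_mem_nhds h)

lemma eventually_nhds_snd {X Y : Type*} [TopologicalSpace X] [TopologicalSpace Y] {p : Y → Prop}
    {a : X} {b : Y} (h : ∀ᶠ c in 𝓝 b, p c) : ∀ᶠ c in 𝓝 (a, b), p c.2 :=
  (continuous_snd.tendsto (a, b)).eventually h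

lemma eventually_isSpread {D w₀ w₁ w₂ w₃ : ℝ × ℝ} (h : IsSpread D w₀ w₁ w₂ w₃) :
    ∀ᶠ c : (ℝ × ℝ) × (ℝ × ℝ) × (ℝ × ℝ) × (ℝ × ℝ) in 𝓝 (w₀, w₁, w₂, w₃),
      IsSpread D c.1 c.2.1 c.2.2.1 c.2.2.2 := by
  have hl : ∀ F : (ℝ × ℝ) × (ℝ × ℝ) × (ℝ × ℝ) × (ℝ × ℝ) → ℝ × ℝ, Continuous F →
      UpperLeft (F (w₀, w₁, w₂, w₃)) → ∀ᶠ c in 𝓝 (w₀, w₁, w₂, w₃), UpperLeft (F c) :=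
    fun F hF h' => (eventually_pos_of_continuousAt (F := fun c => -(F c).1) (by fun_prop) h'.1).and
      (eventually_pos_of_continuousAt (F := fun c => (F c).2) (by fun_prop) h'.2)
  have hr : ∀ F : (ℝ × ℝ) × (ℝ × ℝ) × (ℝ × ℝ) × (ℝ × ℝ) → ℝ × ℝ, Continuous F →
      UpperRight (F (w₀, w₁, w₂, w₃)) → ∀ᶠ c in 𝓝 (w₀, w₁, w₂, w₃), UpperRight (F c) :=
    fun F hF h' => (eventually_pos_of_continuousAt (F := fun c => (F c).1) (by fun_prop) h'.1).and
      (eventually_pos_of_continuousAt (F := fun c => (F c).2) (by fun_prop) h'.2)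
  filter_upwards [hl (fun c => c.2.2.2 - (1, 0) - c.1) (by fun_prop) h.a₀,
    hl (fun c => D + c.2.1 - (1, 0) - c.2.2.2) (by fun_prop) h.a₁,
    hl (fun c => c.2.2.1 - c.2.1 - (1, 0)) (by fun_prop) h.a₂,
    hl (fun c => -c.2.2.1) (by fun_prop) h.a₃, hl (fun c => c.1) (by fun_prop) h.a₄,
    hr (fun c => D + c.2.1 - c.1) (by fun_prop) h.b₀,
    hr (fun c => D + c.2.2.1 - c.2.2.2) (by fun_prop) h.b₁,
    hr (fun c => (1, 0) - c.2.1 - c.2.2.1) (by fun_prop) h.b₂,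
    hr (fun c => (1, 0) + c.1 + c.2.2.2) (by fun_prop) h.b₃] with c a₀ a₁ a₂ a₃ a₄ b₀ b₁ b₂ b₃
  exact ⟨a₀, a₁, a₂, a₃, a₄, b₀, b₁, b₂, b₃⟩

lemma Continuous.cross {X : Type*} [TopologicalSpace X] {F G : X → ℝ × ℝ} (hF : Continuous F)
    (hG : Continuous G) : Continuous fun c => PaperTorus.cross (F c) (G c) := by
  unfold PaperTorus.cross
  fun_prop

/-- The strict inequalities between areas that hold for a tent with infinitesimal heights. -/
structure IsFlatTent (P₀ P₁ P₂ T : ℝ × ℝ) : Prop where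
  h₁ : cross P₀ P₁ < 0
  h₂ : cross P₀ P₁ - cross P₀ P₂ < -cross P₀ P₁ / 10
  h₃ : cross P₀ P₂ - cross P₀ P₁ < -cross P₀ P₁ / 10
  h₄ : cross P₀ P₁ + cross P₀ P₂ + cross P₁ P₂ < 0
  h₅ : -(cross P₀ P₁ + cross P₀ P₂ + cross P₁ P₂) < -cross P₀ P₁ / 10
  h₆ : cross P₂ T < 0
  h₇ : cross P₀ T < cross P₂ T
  h₈ : 0 < cross P₀ T + cross P₁ T
  h₉ : cross P₂ T - cross P₀ T < -cross P₂ T / 10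
  h₁₀ : cross P₀ T + cross P₁ T < -cross P₂ T / 10

/-- With `H` fixed, the left sides of the `small` conditions vanish at `ε = 0` while the right sides
are positive. Every condition but `0 < ε` is therefore open at the flat tent. -/
lemma IsFlatTent.eventually_isTent {P₀ P₁ P₂ T : ℝ × ℝ} {H : ℝ} (h : IsFlatTent P₀ P₁ P₂ T)
    (hH : 0 < H) :
    ∀ᶠ c : (ℝ × ℝ) × (ℝ × ℝ) × (ℝ × ℝ) × (ℝ × ℝ) × ℝ in 𝓝 (P₀, P₁, P₂, T, 0),
      0 < c.2.2.2.2 → IsTent c.1 c.2.1 c.2.2.1 c.2.2.2.1 c.2.2.2.2 H := by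
  obtain ⟨h₁, h₂, h₃, h₄, h₅, h₆, h₇, h₈, h₉, h₁₀⟩ := h
  have key : ∀ F G : (ℝ × ℝ) × (ℝ × ℝ) × (ℝ × ℝ) × (ℝ × ℝ) × ℝ → ℝ, Continuous F → Continuous G →
      F (P₀, P₁, P₂, T, 0) < G (P₀, P₁, P₂, T, 0) → ∀ᶠ c in 𝓝 (P₀, P₁, P₂, T, 0), F c < G c :=
    fun F G hF hG h => hF.continuousAt.eventually_lt hG.continuousAt h
  have c01 : Continuous fun c : (ℝ × ℝ) × (ℝ × ℝ) × (ℝ × ℝ) × (ℝ × ℝ) × ℝ => cross c.1 c.2.1 :=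
    Continuous.cross (by fun_prop) (by fun_prop)
  have c02 : Continuous fun c : (ℝ × ℝ) × (ℝ × ℝ) × (ℝ × ℝ) × (ℝ × ℝ) × ℝ => cross c.1 c.2.2.1 :=
    Continuous.cross (by fun_prop) (by fun_prop)
  have c12 : Continuous fun c : (ℝ × ℝ) × (ℝ × ℝ) × (ℝ × ℝ) × (ℝ × ℝ) × ℝ =>
    cross c.2.1 c.2.2.1 := Continuous.cross (by fun_prop) (by fun_prop)
  have c03 : Continuous fun c : (ℝ × ℝ) × (ℝ × ℝ) × (ℝ × ℝ) × (ℝ × ℝ) × ℝ =>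
    cross c.1 c.2.2.2.1 := Continuous.cross (by fun_prop) (by fun_prop)
  have c13 : Continuous fun c : (ℝ × ℝ) × (ℝ × ℝ) × (ℝ × ℝ) × (ℝ × ℝ) × ℝ =>
    cross c.2.1 c.2.2.2.1 := Continuous.cross (by fun_prop) (by fun_prop)
  have c23 : Continuous fun c : (ℝ × ℝ) × (ℝ × ℝ) × (ℝ × ℝ) × (ℝ × ℝ) × ℝ =>
    cross c.2.2.1 c.2.2.2.1 := Continuous.cross (by fun_prop) (by fun_prop)
  filter_upwards [key _ _ c01 continuous_const h₁,
    key _ _ (c01.sub c02) (c01.neg.div_const 10) h₂,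
    key _ _ (c02.sub c01) (c01.neg.div_const 10) h₃,
    key _ _ ((c01.add c02).add c12) continuous_const h₄,
    key _ _ ((c01.add c02).add c12).neg (c01.neg.div_const 10) h₅,
    key _ _ c23 continuous_const h₆, key _ _ c03 c23 h₇,
    key _ _ continuous_const (c03.add c13) h₈,
    key _ _ (c23.sub c03) (c23.neg.div_const 10) h₉,
    key _ _ (c03.add c13) (c23.neg.div_const 10) h₁₀,
    key (fun c => 100 * c.2.2.2.2 * (-cross c.1 c.2.1 - cross c.2.2.1 c.2.2.2.1))
      (fun c => H * -(cross c.1 c.2.1 + cross c.1 c.2.2.1 + cross c.2.1 c.2.2.1)) (by fun_prop)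
      (by fun_prop) (by simpa using mul_pos hH (neg_pos.2 h₄)),
    key (fun c => 100 * c.2.2.2.2 * (-cross c.1 c.2.1 - cross c.2.2.1 c.2.2.2.1))
      (fun c => H * (cross c.2.2.1 c.2.2.2.1 - cross c.1 c.2.2.2.1)) (by fun_prop)
      (by fun_prop) (by simpa using mul_pos hH (sub_pos.2 h₇)),
    key (fun c => 100 * c.2.2.2.2 * (-cross c.1 c.2.1 - cross c.2.2.1 c.2.2.2.1))
      (fun c => H * (cross c.1 c.2.2.2.1 + cross c.2.1 c.2.2.2.1)) (by fun_prop)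
      (by fun_prop) (by simpa using mul_pos hH h₈)] with c d₁ d₂ d₃ d₄ d₅ d₆ d₇ d₈ d₉ d₁₀ s₁ s₂ s₃ hε
  exact ⟨d₁, d₂, d₃, d₄, d₅, d₆, d₇, d₈, d₉, d₁₀, hε, hH, s₁, s₂, s₃⟩

/-- Multiplied by `y`, each vertical component in question becomes a polynomial in `x` and `y`,
positive because `x² + y² ≥ 1` and `0 < x < 1/2`. -/
lemma isSpread_corner {x y h g v₀ : ℝ} (hx : 0 < x) (hx' : x < 1 / 2) (hy : 0 < y)
    (hN : 1 ≤ x ^ 2 + y ^ 2) (hh : y * h = (x ^ 2 + y ^ 2) / 2) (hg : y * g = x * (1 / 2 - x))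
    (hv₀ : y * v₀ = (x ^ 2 + y ^ 2 - 2 * x) / 2) :
    IsSpread (x, y) (-(1 / 2 - x), g) (1 / 2 - x - x, h - g - y) (1 / 2, h + g - y) (0, v₀) := by
  have pos_of : ∀ z, 0 < y * z → 0 < z := fun z hz => (mul_pos_iff_of_pos_left hy).1 hz
  have hg0 : 0 < g := pos_of g (by rw [hg]; exact mul_pos hx (by linarith))
  have hv00 : 0 < v₀ := pos_of v₀ (by rw [hv₀]; linarith)
  have e1 : 0 < v₀ - g := pos_of _ (by
    rw [mul_sub, hv₀, hg]
    nlinarith [mul_pos (show 0 < 1 - x by linarith) (show 0 < 1 - 2 * x by linarith)])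
  have e2 : 0 < h - g - v₀ := pos_of _ (by
    rw [mul_sub, mul_sub, hv₀, hg, hh]
    nlinarith)
  have e3 : 0 < y - h - g := pos_of _ (by
    rw [mul_sub, mul_sub, hg, hh]
    nlinarith)
  have e4 : 0 < h - 2 * g := pos_of _ (by
    rw [mul_sub, mul_left_comm, hg, hh]
    nlinarith)
  have e5 : 0 < h + g - v₀ := pos_of _ (by
    rw [mul_sub, mul_add, hv₀, hg, hh]
    nlinarith)
  have e6 : 0 < y - h := pos_of _ (by
    rw [mul_sub, hh]
    nlinarith)
  constructor <;> refine ⟨?_, ?_⟩ <;>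
    simp only [Prod.fst_add, Prod.snd_add, Prod.fst_sub, Prod.snd_sub, Prod.fst_neg,
      Prod.snd_neg] <;> linarith

/-- A one-parameter family of flat tents starts at the corner configuration. -/
lemma exists_flat_tent {x y h g : ℝ} (hx : 0 < x) (hx' : x < 1 / 2) (hy : 0 < y)
    (hN : 1 ≤ x ^ 2 + y ^ 2) (hh : y * h = (x ^ 2 + y ^ 2) / 2) (hg : y * g = x * (1 / 2 - x)) :
    ∃ t τ f u v : ℝ, 0 < t ∧ 0 < τ ∧
      τ * (2 * x * (1 + (1 - 2 * x) * t - x * (1 - x) * t ^ 2)) = t * (x ^ 2 + y ^ 2 - 2 * x) ∧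
      f = (x ^ 2 + y ^ 2) * (t * τ) ∧ u = (1 / 2 - x) * (τ - x * (t * τ)) ∧
      y * v = (x ^ 2 + y ^ 2 - 2 * x + f) / 2 - x * u ∧ 0 < 2 * x - f ∧
      0 < 1 + τ - x * (t * τ) ∧
      IsSpread (x, y) (-(1 / 2 - x) - f / 2, g + h * τ) (1 / 2 - x - x, h - g - y)
        (1 / 2, h + g - y) (u, v) ∧
      IsFlatTent (-(1 / 2 - x) - f / 2, g + h * τ) (1 / 2 - x, h - g) (-(1 / 2 - x), h + g)
        (u - τ, v - y * (t * τ)) := by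
  obtain ⟨v₀, hv₀⟩ : ∃ v₀, y * v₀ = (x ^ 2 + y ^ 2 - 2 * x) / 2 := ⟨_, mul_div_cancel₀ _ hy.ne'⟩
  have pos_of : ∀ z, 0 < y * z → 0 < z := fun z hz => (mul_pos_iff_of_pos_left hy).1 hz
  have hh0 : 0 < h := pos_of h (by rw [hh]; positivity)
  have hv00 : 0 < v₀ := pos_of v₀ (by rw [hv₀]; linarith)
  -- The relation defining `τ` is what the length equation `|T| = |w₃|` requires. The numerator is
  -- positive since `x² + y² ≥ 1 > 2x`, and the denominator is close to `2x` for small `t`.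
  obtain ⟨τ, hτ0, hτc, hτ⟩ : ∃ τ : ℝ → ℝ, τ 0 = 0 ∧ ContinuousAt τ 0 ∧ ∀ᶠ t in 𝓝[>] (0 : ℝ),
      0 < t ∧ 0 < τ t ∧ τ t * (2 * x * (1 + (1 - 2 * x) * t - x * (1 - x) * t ^ 2)) =
        t * (x ^ 2 + y ^ 2 - 2 * x) := by
    have hd : ∀ᶠ t in 𝓝 (0 : ℝ), 0 < 2 * x * (1 + (1 - 2 * x) * t - x * (1 - x) * t ^ 2) :=
      eventually_pos_of_continuousAt (by fun_prop) (by simpa using hx)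
    refine ⟨fun t => t * (x ^ 2 + y ^ 2 - 2 * x) /
      (2 * x * (1 + (1 - 2 * x) * t - x * (1 - x) * t ^ 2)), by simp, ?_, ?_⟩
    · exact ContinuousAt.div (by fun_prop) (by fun_prop) (by simpa using hx.ne')
    · filter_upwards [hd.filter_mono nhdsWithin_le_nhds, self_mem_nhdsWithin] with t ht ht0
      exact ⟨ht0, div_pos (mul_pos ht0 (by linarith)) ht, div_mul_cancel₀ _ ht.ne'⟩
  have key : ∀ F : ℝ → ℝ, ContinuousAt F 0 → 0 < F 0 → ∀ᶠ t in 𝓝[>] (0 : ℝ), 0 < F t :=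
    fun F hF hF0 => (eventually_pos_of_continuousAt hF hF0).filter_mono nhdsWithin_le_nhds
  have hfc : ContinuousAt (fun t => (x ^ 2 + y ^ 2) * (t * τ t)) 0 := by fun_prop
  obtain ⟨f, hf⟩ : ∃ f : ℝ → ℝ, ∀ t, f t = (x ^ 2 + y ^ 2) * (t * τ t) := ⟨_, fun _ => rfl⟩
  rw [← funext hf] at hfc
  have huc : ContinuousAt (fun t => (1 / 2 - x) * (τ t - x * (t * τ t))) 0 := by fun_prop
  obtain ⟨u, hu⟩ : ∃ u : ℝ → ℝ, ∀ t, u t = (1 / 2 - x) * (τ t - x * (t * τ t)) := ⟨_, fun _ => rfl⟩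
  rw [← funext hu] at huc
  have hvc : ContinuousAt (fun t => v₀ + (f t / 2 - x * u t) / y) 0 := by fun_prop
  obtain ⟨v, hv⟩ : ∃ v : ℝ → ℝ, ∀ t, v t = v₀ + (f t / 2 - x * u t) / y := ⟨_, fun _ => rfl⟩
  rw [← funext hv] at hvc
  have hf0 : f 0 = 0 := by simp [hf]
  have hu0 : u 0 = 0 := by simp [hu, hτ0]
  have hv0 : v 0 = v₀ := by simp [hv, hf0, hu0]
  have hsp : ∀ᶠ t in 𝓝[>] (0 : ℝ), IsSpread (x, y) (-(1 / 2 - x) - f t / 2, g + h * τ t)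
      (1 / 2 - x - x, h - g - y) (1 / 2, h + g - y) (u t, v t) := by
    have hc : Tendsto (fun t => ((-(1 / 2 - x) - f t / 2, g + h * τ t),
        ((1 / 2 - x - x, h - g - y) : ℝ × ℝ), ((1 / 2, h + g - y) : ℝ × ℝ), (u t, v t))) (𝓝 0)
        (𝓝 ((-(1 / 2 - x), g), (1 / 2 - x - x, h - g - y), (1 / 2, h + g - y), (0, v₀))) := by
      have : ContinuousAt (fun t => ((-(1 / 2 - x) - f t / 2, g + h * τ t),
        ((1 / 2 - x - x, h - g - y) : ℝ × ℝ), ((1 / 2, h + g - y) : ℝ × ℝ), (u t, v t))) 0 := by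
        fun_prop
      simpa only [ContinuousAt, hf0, hτ0, hu0, hv0, zero_div, sub_zero, mul_zero, add_zero]
        using this
    exact (hc.eventually (eventually_isSpread (isSpread_corner hx hx' hy hN hh hg hv₀))).filter_mono
      nhdsWithin_le_nhds
  have hch : 0 < (1 / 2 - x) * h := mul_pos (by linarith) hh0
  have hcv : 0 < (1 / 2 - x) * v₀ := mul_pos (by linarith) hv00
  obtain ⟨X, hX⟩ : ∃ X : ℝ → ℝ, ∀ t, X t =
    cross (-(1 / 2 - x) - f t / 2, g + h * τ t) (1 / 2 - x, h - g) := ⟨_, fun _ => rfl⟩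
  obtain ⟨Y, hY⟩ : ∃ Y : ℝ → ℝ, ∀ t, Y t =
    cross (-(1 / 2 - x) - f t / 2, g + h * τ t) (-(1 / 2 - x), h + g) := ⟨_, fun _ => rfl⟩
  obtain ⟨Z, hZ⟩ : ∃ Z : ℝ, Z =
    cross (1 / 2 - x, h - g) (-(1 / 2 - x), h + g) := ⟨_, rfl⟩
  obtain ⟨p, hp⟩ : ∃ p : ℝ → ℝ, ∀ t, p t =
    cross (-(1 / 2 - x) - f t / 2, g + h * τ t) (u t - τ t, v t - y * (t * τ t)) :=
    ⟨_, fun _ => rfl⟩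
  obtain ⟨q, hq⟩ : ∃ q : ℝ → ℝ, ∀ t, q t =
    cross (1 / 2 - x, h - g) (u t - τ t, v t - y * (t * τ t)) := ⟨_, fun _ => rfl⟩
  obtain ⟨r, hr⟩ : ∃ r : ℝ → ℝ, ∀ t, r t =
    cross (-(1 / 2 - x), h + g) (u t - τ t, v t - y * (t * τ t)) := ⟨_, fun _ => rfl⟩
  have hXc : ContinuousAt X 0 := by rw [funext hX]; unfold cross; fun_prop
  have hYc : ContinuousAt Y 0 := by rw [funext hY]; unfold cross; fun_prop
  have hpc : ContinuousAt p 0 := by rw [funext hp]; unfold cross; fun_prop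
  have hqc : ContinuousAt q 0 := by rw [funext hq]; unfold cross; fun_prop
  have hrc : ContinuousAt r 0 := by rw [funext hr]; unfold cross; fun_prop
  have v1 : X 0 = -((1 / 2 - x) * h) := by rw [hX, hf0, hτ0, cross]; ring
  have v2 : Y 0 = -((1 / 2 - x) * h) := by rw [hY, hf0, hτ0, cross]; ring
  have v3 : Z = 2 * ((1 / 2 - x) * h) := by rw [hZ, cross]; ring
  have v4 : p 0 = -((1 / 2 - x) * v₀) := by rw [hp, hf0, hτ0, hu0, hv0, cross]; ring
  have v5 : q 0 = (1 / 2 - x) * v₀ := by rw [hq, hτ0, hu0, hv0, cross]; ring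
  have v6 : r 0 = -((1 / 2 - x) * v₀) := by rw [hr, hτ0, hu0, hv0, cross]; ring
  have k1 := key (fun t => -X t) (by fun_prop) (by linarith)
  have k2 := key (fun t => -X t / 10 - (X t - Y t)) (by fun_prop) (by linarith)
  have k3 := key (fun t => -X t / 10 - (Y t - X t)) (by fun_prop) (by linarith)
  have k5 := key (fun t => -X t / 10 + (X t + Y t + Z)) (by fun_prop) (by linarith)
  have k6 := key (fun t => -r t) (by fun_prop) (by linarith)
  have k9 := key (fun t => -r t / 10 - (r t - p t)) (by fun_prop) (by linarith)
  have k10 := key (fun t => -r t / 10 - (p t + q t)) (by fun_prop) (by linarith)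
  have kH := key (fun t => 2 * x - f t) (by fun_prop) (by simp only [hf0]; linarith)
  have kv := key (fun t => v t - y * (t * τ t)) (by fun_prop) (by simp only [hv0, hτ0]; linarith)
  have k8 := key (fun t => h * (1 + τ t) * (1 / 2 + x + (1 / 2 - x) * x * t) -
      (x ^ 2 + y ^ 2) * t * (v t - y * (t * τ t)) / 2) (by fun_prop)
      (by simp only [hτ0]; nlinarith)
  have kn := key (fun t => 1 + τ t - x * (t * τ t)) (by fun_prop) (by simp [hτ0])
  have kl := key (fun t => 1 - τ t) (by fun_prop) (by simp [hτ0])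
  obtain ⟨t, ⟨ht, hτt, hτe⟩, hS, c1, c2, c3, c5, c6, c9, c10, cH, cv, c8, cn, cl⟩ :=
    (hτ.and (hsp.and (k1.and (k2.and (k3.and (k5.and (k6.and (k9.and (k10.and (kH.and
      (kv.and (k8.and (kn.and kl))))))))))))).exists
  have hft := hf t
  have hf1 : 0 < f t := by rw [hft]; positivity
  -- At `t = 0` the point `P₀` is the midpoint of `-P₁` and `P₂`, and `T` is parallel to the line
  -- through them, so `h₄`, `h₇` and `h₈` hold only as equalities. They cannot come from continuity.
  -- The factorizations here and in `h7`, `h8` show their signs for `t > 0`; the other inequalities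
  -- are strict at the corner.
  have hS0 : X t + Y t + Z = -(f t * h) := by rw [hX, hY, hZ]; simp only [cross]; ring
  have hTx : u t - τ t = -(τ t * (1 / 2 + x + (1 / 2 - x) * x * t)) := by rw [hu t]; ring
  have hpos1 : 0 < 1 / 2 + x + (1 / 2 - x) * x * t := by
    have : 0 < (1 / 2 - x) * x * t := mul_pos (mul_pos (by linarith) hx) ht
    linarith
  have h7 : p t - r t = -(f t / 2 * (v t - y * (t * τ t)) +
      h * (1 - τ t) * (τ t * (1 / 2 + x + (1 / 2 - x) * x * t))) := by
    rw [hp, hr, hTx]; simp only [cross]; ring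
  have h8 : p t + q t = τ t * (h * (1 + τ t) *
      (1 / 2 + x + (1 / 2 - x) * x * t) - (x ^ 2 + y ^ 2) * t * (v t - y * (t * τ t)) / 2) := by
    rw [hp, hq, hTx]; simp only [cross]; rw [hft]; ring
  have a1 := mul_pos (half_pos hf1) cv
  have a2 := mul_pos (mul_pos hh0 cl) (mul_pos hτt hpos1)
  have a3 := mul_pos hf1 hh0
  have a4 := mul_pos hτt c8
  refine ⟨t, τ t, f t, u t, v t, ht, hτt, hτe, hft, hu t, ?_, cH, cn, hS, ?_⟩
  · rw [hv, mul_add, mul_div_cancel₀ _ hy.ne', hv₀]; ring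
  · clear hfc huc hvc hXc hYc hpc hqc hrc k1 k2 k3 k5 k6 k9 k10 kH kv k8 kn kl hτ hsp key hτc
    constructor <;> simp only [← hX, ← hY, ← hZ, ← hp, ← hq, ← hr] <;> linarith

/-- The eight vertices of a paper torus realizing the flat torus with reduced period lattice. -/
theorem exists_folding {x y : ℝ} (hx : 0 < x) (hx' : x < 1 / 2) (hy : 0 < y)
    (hN : 1 ≤ x ^ 2 + y ^ 2) : ∃ w₀ w₁ w₂ w₃ P₀ P₁ P₂ T ε H,
      IsSpread (x, y) w₀ w₁ w₂ w₃ ∧ IsFolding (x, y) w₀ w₁ w₂ w₃ P₀ P₁ P₂ T ε H ∧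
        IsTent P₀ P₁ P₂ T ε H := by
  obtain ⟨h, hh⟩ : ∃ h, y * h = (x ^ 2 + y ^ 2) / 2 := ⟨_, mul_div_cancel₀ _ hy.ne'⟩
  obtain ⟨g, hg⟩ : ∃ g, y * g = x * (1 / 2 - x) := ⟨_, mul_div_cancel₀ _ hy.ne'⟩
  obtain ⟨t, τ, f, u, v, ht, hτ, hτe, hf, hu, hv, hH, hn, hS, hT⟩ :=
    exists_flat_tent hx hx' hy hN hh hg
  obtain ⟨H, hH0, hH2⟩ : ∃ H : ℝ, 0 < H ∧ H ^ 2 = 2 * x - f :=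
    ⟨√(2 * x - f), Real.sqrt_pos.2 hH, Real.sq_sqrt hH.le⟩
  have htent := hT.eventually_isTent hH0
  have hX := hT.h₁
  have hY := hT.h₃
  have hSg := hT.h₅
  simp only [cross] at hX hY hSg
  have hpert := exists_folding_of_flat (x := x) (y := y) (H := H)
    (a₀ := -(1 / 2 - x) - f / 2) (b₀ := g + h * τ) (a₁ := 1 / 2 - x - x) (b₁ := h - g - y)
    (a₂ := 1 / 2) (b₂ := h + g - y) (a₃ := u) (b₃ := v) (s := u - τ) (t := v - y * (t * τ))
    (Q := fun c => IsSpread (x, y) c.1 c.2.1 c.2.2.1 c.2.2.2.1 ∧ (0 < c.2.2.2.2.2.2.2.2 →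
      IsTent c.2.2.2.2.1 c.2.2.2.2.2.1 c.2.2.2.2.2.2.1 c.2.2.2.2.2.2.2.1 c.2.2.2.2.2.2.2.2 H))
    hy.ne' hH0.ne' rfl
    (by linear_combination hh + hg) (by rw [hH2]; linear_combination hv)
    (by
      subst hf hu
      linear_combination (-2 * (t * τ)) * hv + τ * hτe)
    (by
      subst hf hu
      linear_combination hv + (1 - t * τ) * (hh + hg))
    (by rw [hH2]; ring)
    (by
      subst hf hu
      linear_combination (-(t * τ)) * hg - t * τ * τ * hh)
    (by linear_combination hh - hg)
    (by
      subst hf hu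
      linear_combination (1 - t * τ) * (hh - hg) - (1 / 2) * hH2)
    (by
      have : x * (1 / 2) + y * (h + g - y) < 0 := by
        rw [mul_sub, mul_add, hh, hg]; nlinarith
      exact this.ne)
    (by
      have := mul_pos hy (mul_pos ht hτ)
      intro h0
      linarith)
    (by
      have : 0 < y * (1 + τ - x * (t * τ)) := mul_pos hy hn
      intro h0
      linarith)
    -- The last two nondegeneracy conditions say that `P₀`, `P₁` are linearly independent and that
    -- `P₀`, `P₁`, `P₂` are not collinear. Both follow from the area inequalities.
    (by
      intro h0
      linarith)
    (by
      intro h0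
      linarith)
    (by
      rw [show (1 / 2 - x - x + x, h - g - y + y) = ((1 / 2 - x, h - g) : ℝ × ℝ) by
        congr 1 <;> ring, show (1 / 2 + (x - 1), h + g - y + y) = ((-(1 / 2 - x), h + g) : ℝ × ℝ) by
        congr 1 <;> ring]
      refine Filter.Eventually.and ?_ ?_
      · exact (Continuous.tendsto (f := fun c : (ℝ × ℝ) × (ℝ × ℝ) × (ℝ × ℝ) × (ℝ × ℝ) × (ℝ × ℝ) ×
          (ℝ × ℝ) × (ℝ × ℝ) × (ℝ × ℝ) × ℝ => (c.1, c.2.1, c.2.2.1, c.2.2.2.1)) (by fun_prop)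
          _).eventually (eventually_isSpread hS)
      · exact eventually_nhds_snd (eventually_nhds_snd (eventually_nhds_snd
          (eventually_nhds_snd htent))))
  obtain ⟨ε, ⟨w₀, w₁, w₂, w₃, P₀, P₁, P₂, T, hF, hSp, hTe⟩, hε⟩ :=
    ((hpert.filter_mono nhdsWithin_le_nhds).and (self_mem_nhdsWithin (s := Set.Ioi 0))).exists
  exact ⟨w₀, w₁, w₂, w₃, P₀, P₁, P₂, T, ε, H, hSp, hF, hTe hε⟩

end PaperTorus

/-! ### Reduced bases and reflection symmetry of plane lattices -/

namespace PaperTorus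

open Module

/-- The rotation of the plane by a right angle. -/
def perp (p : E2) : E2 := !₂[-p 1, p 0]

lemma inner_perp (p : E2) : inner ℝ p (perp p) = 0 := by
  simp [PiLp.inner_apply, Fin.sum_univ_two, perp]
  ring

lemma norm_perp (p : E2) : ‖perp p‖ = ‖p‖ := by
  simp [EuclideanSpace.norm_eq, Fin.sum_univ_two, perp, add_comm]

lemma exists_eq_smul_add_smul_perp {p : E2} (hp : p ≠ 0) (v : E2) :
    ∃ s t : ℝ, v = s • p + t • perp p := by
  have h : p 0 ^ 2 + p 1 ^ 2 ≠ 0 := by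
    intro h
    apply hp
    ext i
    fin_cases i
    · simpa using pow_eq_zero_iff (two_ne_zero) |>.1
        (le_antisymm (by linarith [sq_nonneg (p 1)]) (sq_nonneg (p 0)))
    · simpa using pow_eq_zero_iff (two_ne_zero) |>.1
        (le_antisymm (by linarith [sq_nonneg (p 0)]) (sq_nonneg (p 1)))
  refine ⟨(p 0 * v 0 + p 1 * v 1) / (p 0 ^ 2 + p 1 ^ 2),
    (p 0 * v 1 - p 1 * v 0) / (p 0 ^ 2 + p 1 ^ 2), ?_⟩
  ext i
  fin_cases i <;> simp [perp] <;> field_simp <;> ring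

lemma norm_smul_add_smul_sq {p q : E2} (a b : ℝ) :
    ‖a • p + b • q‖ ^ 2 = a ^ 2 * ‖p‖ ^ 2 + 2 * (a * b) * inner ℝ p q + b ^ 2 * ‖q‖ ^ 2 := by
  rw [norm_add_sq_real, norm_smul, norm_smul, mul_pow, mul_pow, inner_smul_left, inner_smul_right,
    Real.norm_eq_abs, Real.norm_eq_abs, sq_abs, sq_abs]
  simp only [conj_trivial]
  ring

lemma exists_norm_le_of_discreteTopology (Λ : Submodule ℤ E2) [DiscreteTopology Λ] {S : Set E2}
    (hS : S ⊆ Λ) (hne : S.Nonempty) : ∃ v ∈ S, ∀ w ∈ S, ‖v‖ ≤ ‖w‖ := by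
  obtain ⟨w₀, hw₀⟩ := hne
  have : DiscreteTopology Λ.toAddSubgroup := inferInstanceAs (DiscreteTopology Λ)
  have hf : (Metric.closedBall (0 : E2) ‖w₀‖ ∩ (Λ : Set E2)).Finite :=
    Metric.finite_isBounded_inter_isClosed DiscreteTopology.isDiscrete Metric.isBounded_closedBall
      (AddSubgroup.isClosed_of_discrete (H := Λ.toAddSubgroup))
  obtain ⟨v, hv, hmin⟩ := Set.exists_min_image (Metric.closedBall (0 : E2) ‖w₀‖ ∩ S) (fun v => ‖v‖)
    (hf.subset (Set.inter_subset_inter_right _ hS)) ⟨w₀, by simp, hw₀⟩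
  refine ⟨v, hv.2, fun w hw => ?_⟩
  rcases le_total ‖w‖ ‖w₀‖ with h | h
  · exact hmin w ⟨by simpa using h, hw⟩
  · exact (by simpa using hv.1 : ‖v‖ ≤ ‖w₀‖).trans h

lemma exists_mem_notMem_span (Λ : Submodule ℤ E2) [DiscreteTopology Λ] [IsZLattice ℝ Λ] (p : E2) :
    ∃ v ∈ Λ, v ∉ Submodule.span ℝ {p} := by
  by_contra! h
  have h1 : (⊤ : Submodule ℝ E2) ≤ Submodule.span ℝ {p} := by
    rw [← IsZLattice.span_top (K := ℝ) (L := Λ)]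
    exact Submodule.span_le.2 h
  have h2 := Submodule.finrank_mono h1
  have h3 := finrank_span_le_card (R := ℝ) ({p} : Set E2)
  rw [finrank_top, finrank_euclideanSpace_fin] at h2
  simp at h3
  omega

/-- Gauss reduction: a lattice in the plane is generated by two shortest independent vectors. -/
lemma exists_reduced_basis (Λ : Submodule ℤ E2) [DiscreteTopology Λ] [IsZLattice ℝ Λ] :
    ∃ p ∈ Λ, ∃ q ∈ Λ, p ≠ 0 ∧ q ∉ Submodule.span ℝ {p} ∧ ‖p‖ ≤ ‖q‖ ∧
      2 * |inner ℝ p q| ≤ ‖p‖ ^ 2 ∧ ∀ v ∈ Λ, ∃ i j : ℤ, v = (i : ℝ) • p + (j : ℝ) • q := by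
  obtain ⟨p, ⟨hp, hp0⟩, hpmin⟩ := exists_norm_le_of_discreteTopology Λ (S := {v | v ∈ Λ ∧ v ≠ 0})
    (fun v hv => hv.1) (by
      obtain ⟨v, hv, hv'⟩ := exists_mem_notMem_span Λ 0
      exact ⟨v, hv, by rintro rfl; exact hv' (Submodule.zero_mem _)⟩)
  obtain ⟨q, ⟨hq, hqp⟩, hqmin⟩ := exists_norm_le_of_discreteTopology Λ
    (S := {v | v ∈ Λ ∧ v ∉ Submodule.span ℝ {p}}) (fun v hv => hv.1) (exists_mem_notMem_span Λ p)
  have hpp : p ∈ Submodule.span ℝ {p} := Submodule.mem_span_singleton_self p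
  have hq0 : q ≠ 0 := fun h => hqp (h ▸ Submodule.zero_mem _)
  have hpq : ‖p‖ ≤ ‖q‖ := hpmin q ⟨hq, hq0⟩
  have hpos : 0 < ‖p‖ ^ 2 := by positivity
  have hpq2 : ‖p‖ ^ 2 ≤ ‖q‖ ^ 2 := by gcongr
  -- Comparing `q` with `q + p` and `q - p`, which are also independent of `p`, bounds the inner
  -- product.
  have hI : 2 * |inner ℝ p q| ≤ ‖p‖ ^ 2 := by
    have h1 := hqmin (q + p) ⟨Λ.add_mem hq hp, fun h => hqp (by
      simpa using Submodule.sub_mem _ h hpp)⟩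
    have h2 := hqmin (q - p) ⟨Λ.sub_mem hq hp, fun h => hqp (by
      simpa using Submodule.add_mem _ h hpp)⟩
    have h1' : ‖q‖ ^ 2 ≤ ‖q + p‖ ^ 2 := by gcongr
    have h2' : ‖q‖ ^ 2 ≤ ‖q - p‖ ^ 2 := by gcongr
    rw [norm_add_sq_real, real_inner_comm] at h1'
    rw [norm_sub_sq_real, real_inner_comm] at h2'
    rcases abs_cases (inner ℝ p q) with h | h <;> linarith
  refine ⟨p, hp, q, hq, hp0, hqp, hpq, hI, fun v hv => ?_⟩
  obtain ⟨a, b, hab⟩ : ∃ a b : ℝ, v = a • p + b • q := by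
    obtain ⟨x, y, hxy⟩ := exists_eq_smul_add_smul_perp hp0 q
    obtain ⟨s, t, hst⟩ := exists_eq_smul_add_smul_perp hp0 v
    have hy : y ≠ 0 := by
      rintro rfl
      exact hqp (Submodule.mem_span_singleton.2 ⟨x, by simp [hxy]⟩)
    refine ⟨s - t / y * x, t / y, ?_⟩
    rw [hst]
    rw [hxy]
    have : t = t / y * y := by field_simp
    nth_rw 1 [this]
    module
  have hr : v - ((round a : ℝ) • p + (round b : ℝ) • q) =
      (a - round a) • p + (b - round b) • q := by
    rw [hab]; module
  have hrΛ : v - ((round a : ℝ) • p + (round b : ℝ) • q) ∈ Λ := by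
    refine Λ.sub_mem hv (Λ.add_mem ?_ ?_)
    · rw [Int.cast_smul_eq_zsmul]; exact Λ.smul_mem _ hp
    · rw [Int.cast_smul_eq_zsmul]; exact Λ.smul_mem _ hq
  rw [hr] at hrΛ
  have ha := abs_sub_round a
  have hb := abs_sub_round b
  obtain ⟨a', ha'⟩ : ∃ a', a' = a - round a := ⟨_, rfl⟩
  obtain ⟨b', hb'⟩ : ∃ b', b' = b - round b := ⟨_, rfl⟩
  rw [← ha'] at hr hrΛ ha
  rw [← hb'] at hr hrΛ hb
  have ha2 : a' ^ 2 ≤ 1 / 4 := by rw [← sq_abs]; nlinarith [abs_nonneg a']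
  have hb2 : b' ^ 2 ≤ 1 / 4 := by rw [← sq_abs]; nlinarith [abs_nonneg b']
  -- A remainder independent of `p` with both coordinates at most `1/2` in absolute value has
  -- squared norm at most `3/4` of `‖q‖ ^ 2`, against the minimality of `q`. Then `a' • p` is
  -- shorter than `p`, hence zero.
  have hb0 : b' = 0 := by
    by_contra hb0
    have h1 := hqmin _ ⟨hrΛ, fun h => hqp (by
      have h2 := Submodule.smul_mem _ b'⁻¹ (Submodule.sub_mem _ h (Submodule.smul_mem _ a' hpp))
      rwa [add_sub_cancel_left, smul_smul, inv_mul_cancel₀ hb0, one_smul] at h2)⟩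
    have h2 : ‖q‖ ^ 2 ≤ ‖a' • p + b' • q‖ ^ 2 := by gcongr
    rw [norm_smul_add_smul_sq] at h2
    have h3 : a' * b' * inner ℝ p q ≤ 1 / 4 * |inner ℝ p q| := by
      refine (le_abs_self _).trans ?_
      rw [abs_mul, abs_mul]
      gcongr
      nlinarith [abs_nonneg a', abs_nonneg b']
    nlinarith
  have ha0 : a' • p = 0 := by
    by_contra ha0
    have h1 := hpmin (a' • p) ⟨by simpa [hb0] using hrΛ, ha0⟩
    rw [norm_smul, Real.norm_eq_abs] at h1
    nlinarith [norm_pos_iff.2 hp0]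
  refine ⟨round a, round b, ?_⟩
  rw [ha0, hb0, zero_smul, add_zero] at hr
  exact sub_eq_zero.1 hr

/-- An orientation-reversing linear isometry that preserves the lattice induces a reflection
symmetry of the flat torus. -/
lemma hasReflectionSymmetry_of_linearIsometryEquiv (Λ : Submodule ℤ E2) [DiscreteTopology Λ]
    [IsZLattice ℝ Λ] (R : E2 ≃ₗᵢ[ℝ] E2) (hR : ∀ v, R (R v) = v)
    (hdet : LinearMap.det (R.toLinearEquiv : E2 →ₗ[ℝ] E2) < 0) (hΛ : ∀ v ∈ Λ, R v ∈ Λ) :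
    HasReflectionSymmetry Λ := by
  let F : (E2 ⧸ Λ) ≃ₗ[ℤ] (E2 ⧸ Λ) := Submodule.Quotient.equiv Λ Λ
    (R.toLinearEquiv.restrictScalars ℤ) (by
      ext v
      simp only [Submodule.mem_map]
      exact ⟨by rintro ⟨w, hw, rfl⟩; exact hΛ w hw, fun hv => ⟨R v, hΛ v hv, hR v⟩⟩)
  have hF : ∀ v : E2, F (Submodule.Quotient.mk v) = Submodule.Quotient.mk (R v) := fun v => rfl
  have hle : ∀ z, ‖F z‖ ≤ ‖z‖ := fun z => by
    refine le_of_forall_pos_lt_add fun δ hδ => ?_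
    obtain ⟨m, rfl, hm⟩ := Submodule.Quotient.norm_mk_lt z hδ
    rw [hF]
    exact (Submodule.Quotient.norm_mk_le Λ _).trans_lt (by rwa [R.norm_map])
  have hFF : ∀ z, F (F z) = z := fun z => by
    obtain ⟨v, rfl⟩ := Submodule.Quotient.mk_surjective Λ z
    rw [hF, hF, hR]
  have hiso : Isometry F := AddMonoidHomClass.isometry_of_norm F fun z =>
    le_antisymm (hle z) (by simpa only [hFF] using hle (F z))
  exact ⟨⟨F.toEquiv, hiso⟩, R.toAffineIsometryEquiv, hdet, fun v => hF v⟩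

/-- The reflection fixes `p`, so preserving the lattice is a condition on the image of `q` alone. -/
lemma hasReflectionSymmetry_of_reflection (Λ : Submodule ℤ E2) [DiscreteTopology Λ]
    [IsZLattice ℝ Λ] {p q : E2} (hp : p ∈ Λ) (hp0 : p ≠ 0)
    (hgen : ∀ v ∈ Λ, ∃ i j : ℤ, v = (i : ℝ) • p + (j : ℝ) • q)
    (hq : (Submodule.span ℝ {p}).reflection q ∈ Λ) : HasReflectionSymmetry Λ := by
  refine hasReflectionSymmetry_of_linearIsometryEquiv Λ (Submodule.span ℝ {p}).reflection
    (Submodule.reflection_reflection _) ?_ fun v hv => ?_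
  · have : Fact (finrank ℝ E2 = 1 + 1) := ⟨finrank_euclideanSpace_fin⟩
    rw [Submodule.det_reflection, Submodule.finrank_orthogonal_span_singleton (n := 1) hp0]
    norm_num
  · obtain ⟨i, j, rfl⟩ := hgen v hv
    rw [map_add, map_smul, map_smul,
      Submodule.reflection_mem_subspace_eq_self (Submodule.mem_span_singleton_self p),
      Int.cast_smul_eq_zsmul, Int.cast_smul_eq_zsmul]
    exact Λ.add_mem (Λ.smul_mem _ hp) (Λ.smul_mem _ hq)

/-- The similarity of the plane that maps the standard basis to two orthogonal vectors of equal
length. -/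
lemma exists_similarity {p p' : E2} (hp : p ≠ 0) (hpp : inner ℝ p p' = 0) (hn : ‖p'‖ = ‖p‖) :
    ∃ ψ : (ℝ × ℝ) ≃L[ℝ] E2, (∀ v, ψ v = (v.1 / 2) • p + (v.2 / 2) • p') ∧
      ∀ v, ‖ψ v‖ ^ 2 = (‖p‖ / 2) ^ 2 * nsq v := by
  let L : (ℝ × ℝ) →ₗ[ℝ] E2 :=
    ((1 / 2 : ℝ) • LinearMap.fst ℝ ℝ ℝ).smulRight p + ((1 / 2 : ℝ) • LinearMap.snd ℝ ℝ ℝ).smulRight p'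
  have hL : ∀ v, L v = (v.1 / 2) • p + (v.2 / 2) • p' := fun v => by
    simp [L, div_eq_inv_mul]
  have hsq : ∀ v, ‖L v‖ ^ 2 = (‖p‖ / 2) ^ 2 * nsq v := fun v => by
    rw [hL, norm_smul_add_smul_sq, hpp, hn, nsq]; ring
  have hinj : Function.Injective L := by
    refine (injective_iff_map_eq_zero L).2 fun v hv => ?_
    have h := hsq v
    have hpos : 0 < (‖p‖ / 2) ^ 2 := by positivity
    rw [hv, norm_zero, zero_pow two_ne_zero, eq_comm, mul_eq_zero_iff_left hpos.ne', nsq] at h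
    ext
    · simpa using (show v.1 = 0 by nlinarith [sq_nonneg v.1, sq_nonneg v.2])
    · simpa using (show v.2 = 0 by nlinarith [sq_nonneg v.1, sq_nonneg v.2])
  exact ⟨(L.linearEquivOfInjective hinj (by simp)).toContinuousLinearEquiv, hL, hsq⟩

/-- The shape of a lattice without reflection symmetry. -/
theorem exists_shape (Λ : Submodule ℤ E2) [DiscreteTopology Λ] [IsZLattice ℝ Λ]
    (hΛ : ¬ HasReflectionSymmetry Λ) :
    ∃ (ψ : (ℝ × ℝ) ≃L[ℝ] E2) (β x y : ℝ), 0 < β ∧ (∀ v, ‖ψ v‖ ^ 2 = β ^ 2 * nsq v) ∧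
      (∀ v, ψ v ∈ Λ ↔
        ∃ i j : ℤ, v = (i : ℝ) • ((x, y) + (x, y) : ℝ × ℝ) + (j : ℝ) • ((2, 0) : ℝ × ℝ)) ∧
      0 < x ∧ x < 1 / 2 ∧ 0 < y ∧ 1 ≤ x ^ 2 + y ^ 2 := by
  obtain ⟨p, hp, q, hq, hp0, hqp, hpq, hI, hgen⟩ := exists_reduced_basis Λ
  obtain ⟨q, hq, hqp, hpq, hI, hI0, hgen⟩ : ∃ q ∈ Λ, q ∉ Submodule.span ℝ {p} ∧ ‖p‖ ≤ ‖q‖ ∧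
      2 * inner ℝ p q ≤ ‖p‖ ^ 2 ∧ 0 ≤ inner ℝ p q ∧
      ∀ v ∈ Λ, ∃ i j : ℤ, v = (i : ℝ) • p + (j : ℝ) • q := by
    rcases le_total 0 (inner ℝ p q) with h | h
    · exact ⟨q, hq, hqp, hpq, by rwa [abs_of_nonneg h] at hI, h, hgen⟩
    · refine ⟨-q, Λ.neg_mem hq, fun h => hqp (by simpa using Submodule.neg_mem _ h), by simpa,
        by rwa [abs_of_nonpos h, ← inner_neg_right] at hI, by simpa [inner_neg_right], fun v hv => ?_⟩
      obtain ⟨i, j, rfl⟩ := hgen v hv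
      exact ⟨i, -j, by push_cast; module⟩
  have hpos : 0 < ‖p‖ ^ 2 := by positivity
  obtain ⟨p', x, y, hpp, hn, hy, hxy⟩ : ∃ (p' : E2) (x y : ℝ), inner ℝ p p' = 0 ∧ ‖p'‖ = ‖p‖ ∧
      0 < y ∧ q = x • p + y • p' := by
    obtain ⟨x, y, hxy⟩ := exists_eq_smul_add_smul_perp hp0 q
    rcases lt_trichotomy y 0 with h | h | h
    · exact ⟨-perp p, x, -y, by rw [inner_neg_right, inner_perp, neg_zero],
        by rw [norm_neg, norm_perp], neg_pos.2 h, by rw [hxy]; module⟩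
    · exact absurd (Submodule.mem_span_singleton.2 ⟨x, by simp [hxy, h]⟩) hqp
    · exact ⟨perp p, x, y, inner_perp p, norm_perp p, h, hxy⟩
  have hix : inner ℝ p q = x * ‖p‖ ^ 2 := by
    rw [hxy, inner_add_right, inner_smul_right, inner_smul_right, hpp, real_inner_self_eq_norm_sq]
    ring
  have hR : (Submodule.span ℝ {p}).reflection q = x • p - y • p' := by
    rw [hxy, map_add, map_smul, map_smul,
      Submodule.reflection_mem_subspace_eq_self (Submodule.mem_span_singleton_self p),
      Submodule.reflection_mem_subspace_orthogonalComplement_eq_neg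
        (Submodule.mem_orthogonal_singleton_iff_inner_right.2 hpp)]
    module
  -- For `x = 0` the lattice is rectangular and the reflection in the line of `p` sends `q` to `-q`.
  -- For `x = 1/2` it is centred rectangular and the reflection sends `q` to `p - q`.
  have hx0 : x ≠ 0 := fun h => hΛ (hasReflectionSymmetry_of_reflection Λ hp hp0 hgen (by
    rw [hR, show x • p - y • p' = -q by rw [hxy, h]; module]
    exact Λ.neg_mem hq))
  have hx2 : x ≠ 1 / 2 := fun h => hΛ (hasReflectionSymmetry_of_reflection Λ hp hp0 hgen (by
    rw [hR, show x • p - y • p' = p - q by rw [hxy, h]; module]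
    exact Λ.sub_mem hp hq))
  rw [hix] at hI hI0
  -- The similarity carries `(2, 0)` to `p` and `(2x, 2y)` to `q`, so `(1, 0)` and `D = (x, y)` are
  -- half-periods.
  obtain ⟨ψ, hψ, hψn⟩ := exists_similarity hp0 hpp hn
  refine ⟨ψ, ‖p‖ / 2, x, y, by positivity, hψn, fun v => ?_,
    lt_of_le_of_ne (nonneg_of_mul_nonneg_left hI0 hpos) hx0.symm,
    lt_of_le_of_ne (by nlinarith) hx2, hy, ?_⟩
  · have key : ∀ i j : ℤ, ψ ((i : ℝ) • ((x, y) + (x, y) : ℝ × ℝ) + (j : ℝ) • ((2, 0) : ℝ × ℝ)) =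
        (j : ℝ) • p + (i : ℝ) • q := fun i j => by
      rw [hψ, hxy]
      simp only [Prod.fst_add, Prod.snd_add, Prod.smul_fst, Prod.smul_snd, smul_eq_mul]
      module
    constructor
    · intro hv
      obtain ⟨i, j, hij⟩ := hgen _ hv
      exact ⟨j, i, ψ.injective (by rw [key, hij])⟩
    · rintro ⟨i, j, rfl⟩
      rw [key, Int.cast_smul_eq_zsmul, Int.cast_smul_eq_zsmul]
      exact Λ.add_mem (Λ.smul_mem _ hp) (Λ.smul_mem _ hq)
  · have h : ‖p‖ ^ 2 ≤ ‖q‖ ^ 2 := by gcongr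
    rw [hxy, norm_smul_add_smul_sq, hpp, hn] at h
    nlinarith

end PaperTorus

theorem mainTheorem2 (Λ : Submodule ℤ PaperTorus.E2) [DiscreteTopology Λ] [IsZLattice ℝ Λ]
    (hΛ : ¬ PaperTorus.HasReflectionSymmetry Λ) :
    PaperTorus.IsRealizedByPaperTorus Λ 8 := by
  obtain ⟨ψ, β, x, y, hβ, hψ, hlat, hx, hx', hy, hN⟩ := PaperTorus.exists_shape Λ hΛ
  obtain ⟨w₀, w₁, w₂, w₃, P₀, P₁, P₂, T, ε, H, hS, hF, hT⟩ :=
    PaperTorus.exists_folding hx hx' hy hN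
  exact PaperTorus.isRealizedByPaperTorus_of_folding Λ ψ hβ hψ hlat hS hF hT
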